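/- Fix $k\ge 1$. A $k$-graph is a countable category $\Lambda$ with a functor $d:\Lambda\to\mathbb N^k$ such that whenever $d(\lambda)=m+n$ there are unique $\mu,\nu\in\Lambda$ with $\lambda=\mu\nu$, $d(\mu)=m$, $d(\nu)=n$; $r(\lambda)$ and $s(\lambda)$ denote the codomain and the domain of $\lambda$. It is row-finite if $\{\lambda : r(\lambda)=v,\ d(\lambda)=n\}$ is finite for all vertices $v$ and $n\in\mathbb N^k$, and locally convex if, for $i\ne j$ and $\lambda,\mu\in\Lambda$ with $d(\lambda)=e_i$, $d(\mu)=e_j$ and $r(\lambda)=r(\mu)$, there are paths of degree $e_j$ with range $s(\lambda)$ and paths of degree $e_i$ with range $s(\mu)$. For $m\in(\mathbb N\cup\{\infty\})^k$ let $\Omega_{k,m}$ be the $k$-graph with objects $\{p\in\mathbb N^k:p\le m\}$ and morphisms $\{(p,q):p\le q\le m\}$, where $r(p,q)=p$, $s(p,q)=q$, $(p,q)(q,t)=(p,t)$ and $d(p,q)=q-p$. A boundary path of $\Lambda$ of degree $d(x)=m$ is a degree-preserving functor $x:\Omega_{k,m}\to\Lambda$ such that, whenever $p\in\mathbb N^k$,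 $p\le m$ and $p_i=m_i$, no path of degree $e_i$ has range $x(p)$. An infinite path is a boundary path of degree $(\infty,\dots,\infty)$. Let $\wedge$ be the coordinatewise minimum, and for a boundary path $x$ and $n\in\mathbb N^k$ with $n\le d(x)$ let $\sigma^n(x)$ be the boundary path of degree $d(x)-n$ with $\sigma^n(x)(p,q)=x(n+p,n+q)$; if $\Lambda$ is locally convex and $s(\lambda)=x(0)$, then $\lambda x$ denotes the unique boundary path of degree $d(\lambda)+d(x)$ with $(\lambda x)(0,d(\lambda))=\lambda$ and $\sigma^{d(\lambda)}(\lambda x)=x$. For row-finite locally convex $\Lambda$, let $\widetilde\Lambda$ be the $k$-graph whose vertices are the classes $[x;m]$ of pairs of a boundary path $x$ of $\Lambda$ and $m\in\mathbb N^k$, where $(x;m)\sim(y;n)$ iff $x(m\wedge d(x))=y(n\wedge d(y))$ and $m-m\wedge d(x)=n-n\wedge d(y)$, and whose paths are the classes $[x;(m,n)]$ with $x$ a boundary path of $\Lambda$ and $m\le n$ in $\mathbb N^k$, where $(x;(m,n))\approx(y;(p,q))$ iff $x(m\wedge d(x),n\wedge d(x))=y(p\wedge d(y),q\wedge d(y))$,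 $m-m\wedge d(x)=p-p\wedge d(y)$ and $n-m=q-p$. Its structure maps are $r([x;(m,n)])=[x;m]$, $s([x;(m,n)])=[x;n]$, $\mathrm{id}_{[x;m]}=[x;(m,m)]$, $d([x;(m,n)])=n-m$ and $[x;(m,n)]\,[y;(p,q)]=[x(0,n\wedge d(x))\,\sigma^{p\wedge d(y)}(y);(m,n+q-p)]$ when $[x;n]=[y;p]$. Let $\pi:\widetilde\Lambda\to\Lambda$ be given by $\pi([x;(m,n)])=x(m\wedge d(x),n\wedge d(x))$. For a boundary path $x$ of $\Lambda$ and $n\in\mathbb N^k$, let $[x;(n,\infty)]$ be the infinite path $(p,q)\mapsto[x;(n+p,n+q)]$ of $\widetilde\Lambda$. Let $\Lambda$ be a row-finite, locally convex $k$-graph and let $y$ be an infinite path of $\widetilde\Lambda$. Then there is exactly one pair $(\pi(y),p_y)$ of a boundary path $\pi(y)$ of $\Lambda$ and $p_y\in\mathbb N^k$ such that $p_y\wedge d(\pi(y))=0$ and $y=[\pi(y);(p_y,\infty)]$. Moreover, for this pair, $$\pi(y(m,n))=\pi(y)\big(m\wedge d(\pi(y)),\,n\wedge d(\pi(y))\big)\qquad\text{for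 all } m\le n \text{ in } \mathbb N^k.$$ -/

import Mathlib

universe u

/-- A `k`-graph: a countable small category, given by its set `Obj` of objects, its set `Mor` of
morphisms (called paths), the codomain map `r` (range), the domain map `s` (source), identities and
the composition `comp f g = f ∘ g = fg` of the pairs with `s f = r g`, together with a degree
functor `d` to `ℕ^k` that has the factorisation property. -/
structure KGraph (k : ℕ) where
  Obj : Type u
  Mor : Type u
  r : Mor → Obj
  s : Mor → Obj
  ident : Obj → Mor
  comp : (f g : Mor) → s f = r g → Mor
  r_ident : ∀ v, r (ident v) = v
  s_ident : ∀ v, s (ident v) = v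
  r_comp : ∀ f g h, r (comp f g h) = r f
  s_comp : ∀ f g h, s (comp f g h) = s g
  ident_comp : ∀ f, comp (ident (r f)) f (s_ident (r f)) = f
  comp_ident : ∀ f, comp f (ident (s f)) (r_ident (s f)).symm = f
  assoc : ∀ (f g h : Mor) (hfg : s f = r g) (hgh : s g = r h),
    comp (comp f g hfg) h ((s_comp f g hfg).trans hgh) =
      comp f (comp g h hgh) (hfg.trans (r_comp g h hgh).symm)
  countable : Countable Mor
  d : Mor → (Fin k → ℕ)
  d_ident : ∀ v, d (ident v) = 0
  d_comp : ∀ f g h, d (comp f g h) = d f + d g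
  factorisation : ∀ (f : Mor) (m n : Fin k → ℕ), d f = m + n →
    ∃! p : {p : Mor × Mor // s p.1 = r p.2},
      d p.1.1 = m ∧ d p.1.2 = n ∧ comp p.1.1 p.1.2 p.2 = f

namespace KGraph

variable {k : ℕ}

/-- `v Λ^n` is finite for all vertices `v` and all `n ∈ ℕ^k`. -/
def RowFinite (Λ : KGraph.{u} k) : Prop :=
  ∀ (v : Λ.Obj) (n : Fin k → ℕ), {f : Λ.Mor | Λ.r f = v ∧ Λ.d f = n}.Finite

/-- `v Λ^{e_i}` is non-empty. -/
def HasEdge (Λ : KGraph.{u} k) (v : Λ.Obj) (i : Fin k) : Prop :=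
  ∃ f : Λ.Mor, Λ.r f = v ∧ Λ.d f = Pi.single i 1

def LocallyConvex (Λ : KGraph.{u} k) : Prop :=
  ∀ (i j : Fin k), i ≠ j → ∀ f g : Λ.Mor, Λ.d f = Pi.single i 1 → Λ.d g = Pi.single j 1 →
    Λ.r f = Λ.r g → Λ.HasEdge (Λ.s f) j ∧ Λ.HasEdge (Λ.s g) i

theorem le_at {m n : Fin k → ℕ} (h : m ≤ n) (i : Fin k) : m i ≤ n i := h i

theorem comp_congr (Λ : KGraph.{u} k) {f f' g g' : Λ.Mor} (h : Λ.s f = Λ.r g)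
    (hf : f = f') (hg : g = g') : Λ.comp f g h = Λ.comp f' g' (hf ▸ hg ▸ h) := by
  subst hf hg; rfl

theorem factor_unique (Λ : KGraph.{u} k) {f g f' g' : Λ.Mor} (h : Λ.s f = Λ.r g)
    (h' : Λ.s f' = Λ.r g') (hc : Λ.comp f g h = Λ.comp f' g' h') (hd : Λ.d f = Λ.d f') :
    f = f' ∧ g = g' := by
  have hd2 : Λ.d g = Λ.d g' := by
    have := congrArg Λ.d hc
    rw [Λ.d_comp, Λ.d_comp, hd] at this
    exact add_left_cancel this
  have := (Λ.factorisation (Λ.comp f g h) (Λ.d f) (Λ.d g) (Λ.d_comp _ _ _)).unique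
    (y₁ := ⟨(f, g), h⟩) (y₂ := ⟨(f', g'), h'⟩) ⟨rfl, rfl, rfl⟩ ⟨hd.symm, hd2.symm, hc.symm⟩
  simpa using this

theorem eq_ident_of_d (Λ : KGraph.{u} k) {f : Λ.Mor} (h : Λ.d f = 0) :
    f = Λ.ident (Λ.r f) := by
  have h1 : Λ.comp (Λ.ident (Λ.r f)) f (Λ.s_ident _) =
      Λ.comp f (Λ.ident (Λ.s f)) (Λ.r_ident _).symm := by
    rw [Λ.ident_comp, Λ.comp_ident]
  exact (Λ.factor_unique _ _ h1 (by rw [Λ.d_ident, h])).1.symm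

theorem exists_factor (Λ : KGraph.{u} k) (f : Λ.Mor) (m n : Fin k → ℕ) (h : Λ.d f = m + n) :
    ∃ a b : Λ.Mor, ∃ hab : Λ.s a = Λ.r b, Λ.d a = m ∧ Λ.d b = n ∧ Λ.comp a b hab = f := by
  obtain ⟨⟨⟨a, b⟩, hab⟩, ⟨h1, h2, h3⟩, -⟩ := Λ.factorisation f m n h
  exact ⟨a, b, hab, h1, h2, h3⟩

/-- `g` is the middle factor of a factorisation `f = a g b` with `d(a) = m`, `d(g) = n - m`. -/
def IsSegment (Λ : KGraph.{u} k) (f : Λ.Mor) (m n : Fin k → ℕ) (g : Λ.Mor) : Prop :=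
  ∃ (a b : Λ.Mor) (hgb : Λ.s g = Λ.r b) (hag : Λ.s a = Λ.r (Λ.comp g b hgb)),
    Λ.d a = m ∧ Λ.d g = n - m ∧ Λ.comp a (Λ.comp g b hgb) hag = f

theorem exists_isSegment (Λ : KGraph.{u} k) (f : Λ.Mor) (m n : Fin k → ℕ) (hmn : m ≤ n)
    (hn : n ≤ Λ.d f) : ∃ g, Λ.IsSegment f m n g := by
  obtain ⟨a, c, hac, ha, hc, hf⟩ := Λ.exists_factor f m (Λ.d f - m)
    (by funext i; have h1 := le_at hmn i; have h2 := le_at hn i; simp only [Pi.add_apply, Pi.sub_apply]; omega)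
  obtain ⟨g, b, hgb, hg, hb, hc'⟩ := Λ.exists_factor c (n - m) (Λ.d f - n)
    (by rw [hc]; funext i; have h1 := le_at hmn i; have h2 := le_at hn i
        simp only [Pi.add_apply, Pi.sub_apply]; omega)
  subst hc'
  exact ⟨g, a, b, hgb, hac, ha, hg, hf⟩

/-- The segment `f(m, n)` of a path, for `m ≤ n ≤ d(f)`. -/
noncomputable def segment (Λ : KGraph.{u} k) (f : Λ.Mor) (m n : Fin k → ℕ) (hmn : m ≤ n)
    (hn : n ≤ Λ.d f) : Λ.Mor :=
  (Λ.exists_isSegment f m n hmn hn).choose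

theorem segment_spec (Λ : KGraph.{u} k) (f : Λ.Mor) (m n : Fin k → ℕ) (hmn : m ≤ n)
    (hn : n ≤ Λ.d f) : Λ.IsSegment f m n (Λ.segment f m n hmn hn) :=
  (Λ.exists_isSegment f m n hmn hn).choose_spec

theorem IsSegment.unique {Λ : KGraph.{u} k} {f : Λ.Mor} {m n : Fin k → ℕ} {g g' : Λ.Mor}
    (h : Λ.IsSegment f m n g) (h' : Λ.IsSegment f m n g') : g = g' := by
  obtain ⟨a, b, hgb, hag, ha, hg, hf⟩ := h
  obtain ⟨a', b', hgb', hag', ha', hg', hf'⟩ := h'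
  have h1 := Λ.factor_unique hag hag' (hf.trans hf'.symm) (ha.trans ha'.symm)
  exact (Λ.factor_unique hgb hgb' h1.2 (hg.trans hg'.symm)).1

theorem segment_eq (Λ : KGraph.{u} k) {f : Λ.Mor} {m n : Fin k → ℕ} (hmn : m ≤ n)
    (hn : n ≤ Λ.d f) {g : Λ.Mor} (h : Λ.IsSegment f m n g) : Λ.segment f m n hmn hn = g :=
  (Λ.segment_spec f m n hmn hn).unique h

theorem d_segment (Λ : KGraph.{u} k) (f : Λ.Mor) (m n : Fin k → ℕ) (hmn : m ≤ n)
    (hn : n ≤ Λ.d f) : Λ.d (Λ.segment f m n hmn hn) = n - m := by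
  obtain ⟨_, _, _, _, _, h, _⟩ := Λ.segment_spec f m n hmn hn
  exact h

theorem segment_comp (Λ : KGraph.{u} k) (f : Λ.Mor) (p q t : Fin k → ℕ) (hpq : p ≤ q)
    (hqt : q ≤ t) (ht : t ≤ Λ.d f) :
    ∃ h : Λ.s (Λ.segment f p q hpq (hqt.trans ht)) = Λ.r (Λ.segment f q t hqt ht),
      Λ.comp _ _ h = Λ.segment f p t (hpq.trans hqt) ht := by
  obtain ⟨a, b, hgb, hag, ha, hg, hf⟩ := Λ.segment_spec f p t (hpq.trans hqt) ht
  generalize Λ.segment f p t (hpq.trans hqt) ht = g at *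
  obtain ⟨g1, g2, h12, hg1, hg2, rfl⟩ := Λ.exists_factor g (q - p) (t - q)
    (by rw [hg]; funext i; have h1 := le_at hpq i; have h2 := le_at hqt i
        simp only [Pi.add_apply, Pi.sub_apply]; omega)
  have h2b : Λ.s g2 = Λ.r b := by rw [← hgb, Λ.s_comp]
  have h1 : Λ.segment f p q hpq (hqt.trans ht) = g1 := by
    refine Λ.segment_eq _ _ ⟨a, Λ.comp g2 b h2b, by rw [Λ.r_comp, h12], ?_, ha, hg1, ?_⟩
    · rw [hag, Λ.r_comp, Λ.r_comp, Λ.r_comp]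
    · rw [← hf]
      exact Λ.comp_congr _ rfl (Λ.assoc _ _ _ h12 h2b).symm
  have ha1 : Λ.s a = Λ.r g1 := by rw [hag, Λ.r_comp, Λ.r_comp]
  have h2 : Λ.segment f q t hqt ht = g2 := by
    refine Λ.segment_eq _ _ ⟨Λ.comp a g1 ha1, b, h2b, ?_, ?_, hg2, ?_⟩
    · rw [Λ.s_comp, Λ.r_comp, h12]
    · rw [Λ.d_comp, ha, hg1]
      funext i; have h1 := le_at hpq i; simp only [Pi.add_apply, Pi.sub_apply]; omega
    · rw [← hf, Λ.assoc a g1 _ ha1 (by rw [Λ.r_comp, h12])]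
      exact Λ.comp_congr _ rfl (Λ.assoc _ _ _ h12 h2b).symm
  exact ⟨by rw [h1, h2, h12], Λ.comp_congr _ h1 h2⟩

/-- Segments of `f` are segments of `f g`. -/
theorem segment_comp_left (Λ : KGraph.{u} k) (f g : Λ.Mor) (h : Λ.s f = Λ.r g)
    (p q : Fin k → ℕ) (hpq : p ≤ q) (hq : q ≤ Λ.d f) (hq' : q ≤ Λ.d (Λ.comp f g h)) :
    Λ.segment (Λ.comp f g h) p q hpq hq' = Λ.segment f p q hpq hq := by
  obtain ⟨a, b, hcb, hac, ha, hc, hf⟩ := Λ.segment_spec f p q hpq hq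
  generalize Λ.segment f p q hpq hq = c at *
  subst hf
  have hbg : Λ.s b = Λ.r g := by rw [← h, Λ.s_comp, Λ.s_comp]
  refine Λ.segment_eq _ _ ⟨a, Λ.comp b g hbg, by rw [Λ.r_comp, hcb], ?_, ha, hc, ?_⟩
  · rw [hac, Λ.r_comp, Λ.r_comp]
  · rw [Λ.assoc a _ g hac (by rw [Λ.s_comp, hbg])]
    exact Λ.comp_congr _ rfl (Λ.assoc _ _ _ _ _).symm

/-- Objects of `Ω_{k,m}`. -/
def OmegaObj (m : Fin k → ℕ∞) : Type := {p : Fin k → ℕ // ∀ i, (p i : ℕ∞) ≤ m i}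

/-- Morphisms `(p, q)` of `Ω_{k,m}`. -/
@[ext]
structure OmegaMor (m : Fin k → ℕ∞) where
  p : Fin k → ℕ
  q : Fin k → ℕ
  le : p ≤ q
  le_deg : ∀ i, (q i : ℕ∞) ≤ m i

theorem le_deg_of_le {m : Fin k → ℕ∞} {p q : Fin k → ℕ} (h : p ≤ q)
    (hq : ∀ i, (q i : ℕ∞) ≤ m i) (i : Fin k) : (p i : ℕ∞) ≤ m i :=
  (Nat.cast_le.2 (h i)).trans (hq i)

/-- The `k`-graph `Ω_{k,m}`, for `m ∈ (ℕ ∪ {∞})^k`. -/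
def Omega (k : ℕ) (m : Fin k → ℕ∞) : KGraph.{0} k where
  Obj := OmegaObj m
  Mor := OmegaMor m
  r f := ⟨f.p, le_deg_of_le f.le f.le_deg⟩
  s f := ⟨f.q, f.le_deg⟩
  ident v := ⟨v.1, v.1, le_rfl, v.2⟩
  comp f g h := ⟨f.p, g.q, f.le.trans ((congrArg Subtype.val h).trans_le g.le), g.le_deg⟩
  r_ident _ := rfl
  s_ident _ := rfl
  r_comp _ _ _ := rfl
  s_comp _ _ _ := rfl
  ident_comp _ := rfl
  comp_ident _ := rfl
  assoc _ _ _ _ _ := rfl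
  countable := by
    have : Function.Injective (fun f : OmegaMor m => (f.p, f.q)) := by
      intro f g h
      simp only [Prod.mk.injEq] at h
      exact OmegaMor.ext h.1 h.2
    exact this.countable
  d f := f.q - f.p
  d_ident v := by funext i; simp
  d_comp f g h := by
    have h' : f.q = g.p := congrArg Subtype.val h
    funext i
    have h1 : f.p i ≤ f.q i := f.le i
    have h2 : g.p i ≤ g.q i := g.le i
    have h3 : f.q i = g.p i := congrFun h' i
    change g.q i - f.p i = (f.q i - f.p i) + (g.q i - g.p i)
    omega
  factorisation f a b hab := by
    have hq : f.q = f.p + a + b := by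
      funext i
      have h1 : f.p i ≤ f.q i := f.le i
      have h2 : f.q i - f.p i = a i + b i := congrFun hab i
      change f.q i = f.p i + a i + b i
      omega
    have hle : f.p + a ≤ f.q := by rw [hq]; exact le_self_add
    refine ⟨⟨(⟨f.p, f.p + a, le_self_add, le_deg_of_le hle f.le_deg⟩,
      ⟨f.p + a, f.q, hle, f.le_deg⟩), rfl⟩, ⟨?_, ?_, rfl⟩, ?_⟩
    · exact add_tsub_cancel_left _ _
    · change f.q - (f.p + a) = b
      rw [hq]; exact add_tsub_cancel_left _ _
    · rintro ⟨⟨g, h⟩, hgh⟩ ⟨hg, -, rfl⟩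
      have e1 : g.q = h.p := congrArg Subtype.val hgh
      have e2 : g.q = g.p + a := by
        rw [← hg]; exact (add_tsub_cancel_of_le g.le).symm
      refine Subtype.ext (Prod.ext (OmegaMor.ext rfl e2) (OmegaMor.ext (e1.symm.trans e2) rfl))

/-- A degree-preserving functor `Ω_{k,m} → Λ`. -/
structure OmegaHom (m : Fin k → ℕ∞) (Λ : KGraph.{u} k) where
  obj : (Omega k m).Obj → Λ.Obj
  map : (Omega k m).Mor → Λ.Mor
  r_map : ∀ f, Λ.r (map f) = obj ((Omega k m).r f)
  s_map : ∀ f, Λ.s (map f) = obj ((Omega k m).s f)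
  map_ident : ∀ v, map ((Omega k m).ident v) = Λ.ident (obj v)
  map_comp : ∀ f g h, map ((Omega k m).comp f g h) =
    Λ.comp (map f) (map g) ((s_map f).trans ((congrArg obj h).trans (r_map g).symm))
  d_map : ∀ f, Λ.d (map f) = (Omega k m).d f

namespace OmegaHom

variable {m : Fin k → ℕ∞} {Λ : KGraph.{u} k}

/-- The path `x(p, q)`. -/
def seg (x : OmegaHom m Λ) (p q : Fin k → ℕ) (hpq : p ≤ q) (hq : ∀ i, (q i : ℕ∞) ≤ m i) : Λ.Mor :=
  x.map ⟨p, q, hpq, hq⟩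

/-- The vertex `x(p)`. -/
def vert (x : OmegaHom m Λ) (p : Fin k → ℕ) (hp : ∀ i, (p i : ℕ∞) ≤ m i) : Λ.Obj :=
  x.obj ⟨p, hp⟩

theorem seg_congr (x : OmegaHom m Λ) {p q p' q' : Fin k → ℕ} (hpq : p ≤ q)
    (hq : ∀ i, (q i : ℕ∞) ≤ m i) (hp' : p = p') (hq' : q = q') :
    x.seg p q hpq hq = x.seg p' q' (hp' ▸ hq' ▸ hpq) (hq' ▸ hq) := by
  subst hp' hq'; rfl

theorem vert_congr (x : OmegaHom m Λ) {p p' : Fin k → ℕ} (hp : ∀ i, (p i : ℕ∞) ≤ m i)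
    (hp' : p = p') : x.vert p hp = x.vert p' (hp' ▸ hp) := by
  subst hp'; rfl

theorem r_seg (x : OmegaHom m Λ) (p q : Fin k → ℕ) (hpq : p ≤ q) (hq : ∀ i, (q i : ℕ∞) ≤ m i) :
    Λ.r (x.seg p q hpq hq) = x.vert p (le_deg_of_le hpq hq) := x.r_map _

theorem s_seg (x : OmegaHom m Λ) (p q : Fin k → ℕ) (hpq : p ≤ q) (hq : ∀ i, (q i : ℕ∞) ≤ m i) :
    Λ.s (x.seg p q hpq hq) = x.vert q hq := x.s_map _

theorem d_seg (x : OmegaHom m Λ) (p q : Fin k → ℕ) (hpq : p ≤ q) (hq : ∀ i, (q i : ℕ∞) ≤ m i) :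
    Λ.d (x.seg p q hpq hq) = q - p := x.d_map _

theorem seg_comp (x : OmegaHom m Λ) (p q t : Fin k → ℕ) (hpq : p ≤ q) (hqt : q ≤ t)
    (ht : ∀ i, (t i : ℕ∞) ≤ m i)
    (h : Λ.s (x.seg p q hpq (le_deg_of_le hqt ht)) = Λ.r (x.seg q t hqt ht)) :
    Λ.comp _ _ h = x.seg p t (hpq.trans hqt) ht :=
  (x.map_comp ⟨p, q, hpq, le_deg_of_le hqt ht⟩ ⟨q, t, hqt, ht⟩ rfl).symm

/-- A composition-preserving and degree-preserving assignment of paths is a functor. -/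
def ofMap (F : OmegaMor m → Λ.Mor) (hd : ∀ f, Λ.d (F f) = f.q - f.p)
    (hc : ∀ (p q t : Fin k → ℕ) (hpq : p ≤ q) (hqt : q ≤ t) (ht : ∀ i, (t i : ℕ∞) ≤ m i),
      ∃ h : Λ.s (F ⟨p, q, hpq, le_deg_of_le hqt ht⟩) = Λ.r (F ⟨q, t, hqt, ht⟩),
        Λ.comp _ _ h = F ⟨p, t, hpq.trans hqt, ht⟩) : OmegaHom m Λ where
  obj v := Λ.r (F ⟨v.1, v.1, le_rfl, v.2⟩)
  map := F
  r_map f := by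
    obtain ⟨h1, h2⟩ := hc f.p f.p f.q le_rfl f.le f.le_deg
    have := congrArg Λ.r h2
    rw [Λ.r_comp] at this
    exact this.symm
  s_map f := (hc f.p f.q f.q f.le le_rfl f.le_deg).1
  map_ident v := Λ.eq_ident_of_d ((hd ⟨v.1, v.1, le_rfl, v.2⟩).trans (tsub_self v.1))
  map_comp f g h := by
    obtain ⟨p, q, hpq, hq⟩ := f
    obtain ⟨q', t, hqt, ht⟩ := g
    obtain rfl : q = q' := congrArg Subtype.val h
    exact (hc p q t hpq hqt ht).2.symm
  d_map f := hd f

theorem ext_seg {x y : OmegaHom m Λ}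
    (h : ∀ p q hpq hq, x.seg p q hpq hq = y.seg p q hpq hq) : x = y := by
  have hm : x.map = y.map := funext fun f => h f.p f.q f.le f.le_deg
  have ho : x.obj = y.obj := by
    funext v
    have h1 := x.map_ident v
    rw [hm, y.map_ident v] at h1
    have := congrArg Λ.r h1
    rw [Λ.r_ident, Λ.r_ident] at this
    exact this.symm
  cases x; cases y
  subst hm ho
  rfl

end OmegaHom

/-- The infinite paths of `Λ`: degree-preserving functors on `Ω_{k,m}` for `m = (∞, …, ∞)`. -/
abbrev InfinitePath (Λ : KGraph.{u} k) : Type u := OmegaHom (fun _ : Fin k => (⊤ : ℕ∞)) Λ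

/-- The path `y(m, n)`, for an infinite path `y`. -/
def InfinitePath.path {Λ : KGraph.{u} k} (y : Λ.InfinitePath) (m n : Fin k → ℕ) (h : m ≤ n) :
    Λ.Mor :=
  y.seg m n h fun _ => le_top

/-- A boundary path of `Λ`, with its degree `deg ∈ (ℕ ∪ {∞})^k`. -/
structure BoundaryPath (Λ : KGraph.{u} k) where
  deg : Fin k → ℕ∞
  hom : OmegaHom deg Λ
  boundary : ∀ (p : Fin k → ℕ) (hp : ∀ i, (p i : ℕ∞) ≤ deg i) (i : Fin k),
    (p i : ℕ∞) = deg i → ¬ Λ.HasEdge (hom.vert p hp) i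

/-- The minimum `m ∧ d`, in `ℕ^k`, of `m ∈ ℕ^k` and `d ∈ (ℕ ∪ {∞})^k`. -/
noncomputable def meet (m : Fin k → ℕ) (d : Fin k → ℕ∞) : Fin k → ℕ := fun i => (min (m i : ℕ∞) (d i)).toNat

theorem coe_meet (m : Fin k → ℕ) (d : Fin k → ℕ∞) (i : Fin k) :
    (meet m d i : ℕ∞) = min (m i : ℕ∞) (d i) :=
  ENat.natCast_toNat (ne_top_of_le_ne_top (ENat.natCast_ne_top (m i)) (min_le_left _ _))

theorem meet_le_right (m : Fin k → ℕ) (d : Fin k → ℕ∞) (i : Fin k) : (meet m d i : ℕ∞) ≤ d i := by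
  rw [coe_meet]; exact min_le_right _ _

theorem meet_le_left (m : Fin k → ℕ) (d : Fin k → ℕ∞) : meet m d ≤ m := fun i => by
  have h := coe_meet m d i
  have : (meet m d i : ℕ∞) ≤ m i := by rw [h]; exact min_le_left _ _
  exact_mod_cast this

theorem meet_mono {m n : Fin k → ℕ} (h : m ≤ n) (d : Fin k → ℕ∞) : meet m d ≤ meet n d := fun i => by
  have : (meet m d i : ℕ∞) ≤ meet n d i := by
    rw [coe_meet, coe_meet]; exact min_le_min_right _ (Nat.cast_le.2 (h i))
  exact_mod_cast this

theorem meet_apply_top (m : Fin k → ℕ) (d : Fin k → ℕ∞) (i : Fin k) (h : d i = ⊤) :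
    meet m d i = m i := by simp [meet, h]

theorem meet_apply_coe (m : Fin k → ℕ) (d : Fin k → ℕ∞) (i : Fin k) (c : ℕ) (h : d i = c) :
    meet m d i = min (m i) c := by
  have := coe_meet m d i
  rw [h, ← Nat.mono_cast.map_min] at this
  exact Nat.cast_injective this

namespace BoundaryPath

variable {Λ : KGraph.{u} k}

/-- The path `x(p, q)`. -/
def seg (x : Λ.BoundaryPath) (p q : Fin k → ℕ) (hpq : p ≤ q)
    (hq : ∀ i, (q i : ℕ∞) ≤ x.deg i) : Λ.Mor :=
  x.hom.seg p q hpq hq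

/-- The vertex `x(p)`. -/
def vert (x : Λ.BoundaryPath) (p : Fin k → ℕ) (hp : ∀ i, (p i : ℕ∞) ≤ x.deg i) : Λ.Obj :=
  x.hom.vert p hp

/-- The range `r(x) = x(0)`. -/
def range (x : Λ.BoundaryPath) : Λ.Obj := x.vert 0 (by simp)

/-- The path `x(m ∧ d(x), n ∧ d(x))`. -/
noncomputable def meetSeg (x : Λ.BoundaryPath) (m n : Fin k → ℕ) (h : m ≤ n) : Λ.Mor :=
  x.seg (meet m x.deg) (meet n x.deg) (meet_mono h _) (meet_le_right _ _)

/-- The vertex `x(m ∧ d(x))`. -/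
noncomputable def meetVert (x : Λ.BoundaryPath) (m : Fin k → ℕ) : Λ.Obj :=
  x.vert (meet m x.deg) (meet_le_right _ _)

theorem add_le_of_le_sub {a : ℕ∞} {n q : ℕ} (hn : (n : ℕ∞) ≤ a) (hq : (q : ℕ∞) ≤ a - n) :
    ((q + n : ℕ) : ℕ∞) ≤ a := by
  induction a using ENat.recTopCoe with
  | top => exact le_top
  | coe c => norm_cast at *; omega

/-- The shift `σ^n(x)`, for `n ≤ d(x)`. -/
def shift (x : Λ.BoundaryPath) (n : Fin k → ℕ) (hn : ∀ i, (n i : ℕ∞) ≤ x.deg i) :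
    Λ.BoundaryPath where
  deg i := x.deg i - n i
  hom := OmegaHom.ofMap
    (fun f => x.seg (f.p + n) (f.q + n) (add_le_add_left f.le n)
      fun i => add_le_of_le_sub (hn i) (f.le_deg i))
    (fun f => by
      rw [seg, OmegaHom.d_seg]; funext i
      simp only [Pi.sub_apply, Pi.add_apply]; omega)
    (fun p q t hpq hqt ht => ⟨(x.hom.s_seg _ _ _ _).trans (x.hom.r_seg _ _ _ _).symm,
      x.hom.seg_comp _ _ _ _ _ _ _⟩)
  boundary p hp i hi := by
    have h := x.boundary (p + n) (fun i => add_le_of_le_sub (hn i) (hp i)) i (by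
      have h1 := hn i
      simp only [Pi.add_apply, Nat.cast_add]
      rw [hi]; exact tsub_add_cancel_of_le h1)
    rwa [← x.hom.r_seg _ _ le_rfl] at h

theorem shift_seg (x : Λ.BoundaryPath) (n : Fin k → ℕ) (hn : ∀ i, (n i : ℕ∞) ≤ x.deg i)
    (p q : Fin k → ℕ) (hpq : p ≤ q) (hq : ∀ i, (q i : ℕ∞) ≤ (x.shift n hn).deg i) :
    (x.shift n hn).seg p q hpq hq = x.seg (p + n) (q + n) (add_le_add_left hpq n)
      (fun i => add_le_of_le_sub (hn i) (hq i)) := rfl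

theorem shift_range (x : Λ.BoundaryPath) (n : Fin k → ℕ) (hn : ∀ i, (n i : ℕ∞) ≤ x.deg i) :
    (x.shift n hn).range = x.vert n hn := by
  change Λ.r (x.seg (0 + n) (0 + n) _ _) = _
  rw [seg, OmegaHom.r_seg]
  exact x.hom.vert_congr _ (zero_add n)

/-- The path `f x(0, t)`. -/
def prolong (f : Λ.Mor) (x : Λ.BoundaryPath) (h : Λ.s f = x.range) (t : Fin k → ℕ)
    (ht : ∀ i, (t i : ℕ∞) ≤ x.deg i) : Λ.Mor :=
  Λ.comp f (x.seg 0 t zero_le ht) (h.trans (x.hom.r_seg _ _ _ _).symm)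

theorem d_prolong (f : Λ.Mor) (x : Λ.BoundaryPath) (h : Λ.s f = x.range) (t : Fin k → ℕ)
    (ht : ∀ i, (t i : ℕ∞) ≤ x.deg i) : Λ.d (prolong f x h t ht) = Λ.d f + t := by
  rw [prolong, Λ.d_comp, seg, OmegaHom.d_seg, tsub_zero]

theorem segment_prolong (f : Λ.Mor) (x : Λ.BoundaryPath) (h : Λ.s f = x.range)
    (t t' : Fin k → ℕ) (htt : t ≤ t') (ht : ∀ i, (t' i : ℕ∞) ≤ x.deg i)
    (p q : Fin k → ℕ) (hpq : p ≤ q)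
    (hq : q ≤ Λ.d (prolong f x h t (le_deg_of_le htt ht)))
    (hq' : q ≤ Λ.d (prolong f x h t' ht)) :
    Λ.segment (prolong f x h t (le_deg_of_le htt ht)) p q hpq hq =
      Λ.segment (prolong f x h t' ht) p q hpq hq' := by
  have h1 : Λ.s (x.seg 0 t zero_le (le_deg_of_le htt ht)) = Λ.r (x.seg t t' htt ht) :=
    (x.hom.s_seg _ _ _ _).trans (x.hom.r_seg _ _ _ _).symm
  have h0 : Λ.s f = Λ.r (x.seg 0 t zero_le (le_deg_of_le htt ht)) :=
    h.trans (x.hom.r_seg _ _ _ _).symm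
  have h2 : prolong f x h t' ht =
      Λ.comp (prolong f x h t (le_deg_of_le htt ht)) (x.seg t t' htt ht)
        (by rw [prolong, Λ.s_comp, h1]) := by
    rw [prolong]
    refine Eq.trans ?_ (Λ.assoc _ _ _ h0 h1).symm
    exact Λ.comp_congr _ rfl (x.hom.seg_comp _ _ _ _ _ _ _).symm
  revert hq'
  rw [h2]
  intro hq'
  exact (Λ.segment_comp_left _ _ _ p q hpq hq hq').symm

theorem concat_le {a : ℕ∞} {n q : ℕ} (hq : (q : ℕ∞) ≤ n + a) : ((q - n : ℕ) : ℕ∞) ≤ a := by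
  induction a using ENat.recTopCoe with
  | top => exact le_top
  | coe c => norm_cast at *; omega

/-- `f x` restricted to `(p, q)`, as a segment of `f x(0, t)` with `t = (q - d(f)) ∨ 0`. -/
noncomputable def concatMap (f : Λ.Mor) (x : Λ.BoundaryPath) (h : Λ.s f = x.range)
    (g : OmegaMor (fun i => (Λ.d f i : ℕ∞) + x.deg i)) : Λ.Mor :=
  Λ.segment (prolong f x h (g.q - Λ.d f) (fun i => concat_le (g.le_deg i))) g.p g.q g.le
    (by rw [d_prolong]; exact le_add_tsub)

theorem concatMap_eq (f : Λ.Mor) (x : Λ.BoundaryPath) (h : Λ.s f = x.range)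
    (g : OmegaMor (fun i => (Λ.d f i : ℕ∞) + x.deg i)) (t : Fin k → ℕ)
    (ht : ∀ i, (t i : ℕ∞) ≤ x.deg i) (hgt : g.q ≤ Λ.d f + t) :
    concatMap f x h g = Λ.segment (prolong f x h t ht) g.p g.q g.le (by rwa [d_prolong]) :=
  segment_prolong f x h (g.q - Λ.d f) t (tsub_le_iff_left.2 hgt) ht g.p g.q g.le _ _

/-- `f x`, as a degree-preserving functor. -/
noncomputable def concatHom (f : Λ.Mor) (x : Λ.BoundaryPath) (h : Λ.s f = x.range) :
    OmegaHom (fun i => (Λ.d f i : ℕ∞) + x.deg i) Λ :=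
  OmegaHom.ofMap (concatMap f x h) (fun g => Λ.d_segment _ _ _ _ _)
    (fun p q t hpq hqt ht => by
      have ht' : ∀ i, (((t - Λ.d f) i : ℕ) : ℕ∞) ≤ x.deg i := fun i => concat_le (ht i)
      have hle : t ≤ Λ.d f + (t - Λ.d f) := le_add_tsub
      rw [concatMap_eq f x h ⟨p, q, hpq, le_deg_of_le hqt ht⟩ _ ht' (hqt.trans hle),
        concatMap_eq f x h ⟨q, t, hqt, ht⟩ _ ht' hle,
        concatMap_eq f x h ⟨p, t, hpq.trans hqt, ht⟩ _ ht' hle]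
      exact Λ.segment_comp _ _ _ _ _ _ _)

theorem concatHom_seg_zero (f : Λ.Mor) (x : Λ.BoundaryPath) (h : Λ.s f = x.range)
    (p q : Fin k → ℕ) (hpq : p ≤ q) (hq : q ≤ Λ.d f)
    (hq' : ∀ i, (q i : ℕ∞) ≤ (Λ.d f i : ℕ∞) + x.deg i) :
    (concatHom f x h).seg p q hpq hq' = Λ.segment f p q hpq hq :=
  Λ.segment_comp_left f _ _ p q hpq hq (by
    rw [Λ.d_comp]; exact hq.trans le_self_add)

theorem concatHom_seg_d (f : Λ.Mor) (x : Λ.BoundaryPath) (h : Λ.s f = x.range)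
    (p q : Fin k → ℕ) (hpq : p ≤ q) (hq : ∀ i, (q i : ℕ∞) ≤ x.deg i)
    (hq' : ∀ i, ((Λ.d f + q) i : ℕ∞) ≤ (Λ.d f i : ℕ∞) + x.deg i) :
    (concatHom f x h).seg (Λ.d f + p) (Λ.d f + q) (add_le_add_right hpq _) hq' =
      x.seg p q hpq hq := by
  have h0 : Λ.s f = Λ.r (x.seg 0 p zero_le (le_deg_of_le hpq hq)) :=
    h.trans (x.hom.r_seg _ _ _ _).symm
  have h1 : Λ.s (x.seg 0 p zero_le (le_deg_of_le hpq hq)) = Λ.r (x.seg p q hpq hq) :=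
    (x.hom.s_seg _ _ _ _).trans (x.hom.r_seg _ _ _ _).symm
  refine (concatMap_eq f x h ⟨_, _, add_le_add_right hpq _, hq'⟩ q hq le_rfl).trans ?_
  refine Λ.segment_eq _ _ ⟨Λ.comp f _ h0, Λ.ident (Λ.s (x.seg p q hpq hq)),
    (Λ.r_ident _).symm, ?_, ?_, ?_, ?_⟩
  · rw [Λ.s_comp, Λ.comp_ident, h1]
  · rw [Λ.d_comp, seg, OmegaHom.d_seg, tsub_zero]
  · rw [seg, OmegaHom.d_seg]; funext i; simp only [Pi.sub_apply, Pi.add_apply]; omega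
  · rw [prolong, Λ.comp_congr _ rfl (Λ.comp_ident (x.seg p q hpq hq)), Λ.assoc _ _ _ h0 h1]
    exact Λ.comp_congr _ rfl (x.hom.seg_comp _ _ _ _ _ _ _)

end BoundaryPath

/-- In a locally convex graph, edges of degree `e_i` propagate along paths `f` with `d(f)_i = 0`. -/
theorem LocallyConvex.hasEdge_source {Λ : KGraph.{u} k} (hlc : Λ.LocallyConvex) (i : Fin k) :
    ∀ (N : ℕ) (f : Λ.Mor), ∑ j, Λ.d f j = N → Λ.d f i = 0 → Λ.HasEdge (Λ.r f) i →
      Λ.HasEdge (Λ.s f) i := by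
  intro N
  induction N with
  | zero =>
    intro f hf _ he
    have hd : Λ.d f = 0 := by
      funext j
      exact (Finset.sum_eq_zero_iff.1 hf) j (Finset.mem_univ j)
    rw [Λ.eq_ident_of_d hd] at he ⊢
    rwa [Λ.s_ident, ← Λ.r_ident (Λ.r f)]
  | succ N ih =>
    intro f hf hi he
    obtain ⟨j, hj⟩ : ∃ j, Λ.d f j ≠ 0 := by
      by_contra! hc
      simp [hc] at hf
    have hij : j ≠ i := by rintro rfl; exact hj hi
    have hsum : Λ.d f = Pi.single j 1 + (Λ.d f - Pi.single j 1) := by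
      refine (add_tsub_cancel_of_le fun l => ?_).symm
      by_cases hl : l = j
      · subst hl; simp; omega
      · simp [hl]
    obtain ⟨a, b, hab, ha, hb, rfl⟩ := Λ.exists_factor f _ _ hsum
    rw [Λ.s_comp]
    rw [Λ.r_comp] at he
    obtain ⟨e, he1, he2⟩ := he
    refine ih b ?_ ?_ ?_
    · have h2 : ∑ l, (Λ.d a l + Λ.d b l) = N + 1 := by
        rw [← hf]; exact Finset.sum_congr rfl fun l _ => by rw [Λ.d_comp]; rfl
      rw [Finset.sum_add_distrib, ha] at h2
      simp at h2
      omega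
    · rw [Λ.d_comp] at hi
      simp only [Pi.add_apply] at hi
      omega
    · rw [← hab]
      exact (hlc j i hij a e ha he2 he1.symm).1

namespace BoundaryPath

variable {Λ : KGraph.{u} k}

theorem concat_boundary (hlc : Λ.LocallyConvex) (f : Λ.Mor) (x : Λ.BoundaryPath)
    (h : Λ.s f = x.range) (p : Fin k → ℕ)
    (hp : ∀ i, (p i : ℕ∞) ≤ (Λ.d f i : ℕ∞) + x.deg i) (i : Fin k)
    (hi : (p i : ℕ∞) = (Λ.d f i : ℕ∞) + x.deg i) :
    ¬ Λ.HasEdge ((concatHom f x h).vert p hp) i := by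
  intro he
  have hp' : ∀ i, (((p - Λ.d f) i : ℕ) : ℕ∞) ≤ x.deg i := fun i => concat_le (hp i)
  have hle : p ≤ Λ.d f + (p - Λ.d f) := le_add_tsub
  have hle' : ∀ j, (((Λ.d f + (p - Λ.d f)) j : ℕ) : ℕ∞) ≤ (Λ.d f j : ℕ∞) + x.deg j := fun j => by
    rw [Pi.add_apply, Nat.cast_add]
    exact add_le_add_right (hp' j) _
  have hpi : Λ.d f i ≤ p i := by
    have : (Λ.d f i : ℕ∞) ≤ p i := by rw [hi]; exact le_self_add
    exact_mod_cast this
  rw [← (concatHom f x h).r_seg p _ hle hle'] at he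
  have he2 := hlc.hasEdge_source i _ _ rfl (by
    rw [OmegaHom.d_seg]; simp only [Pi.sub_apply, Pi.add_apply]; omega) he
  rw [OmegaHom.s_seg, ← (concatHom f x h).r_seg _ _ le_rfl hle',
    concatHom_seg_d f x h _ _ le_rfl hp', seg, OmegaHom.r_seg] at he2
  refine x.boundary _ hp' i ?_ he2
  have hc : x.deg i ≠ ⊤ := by
    intro ht; rw [ht, add_top] at hi; exact ENat.natCast_ne_top _ hi
  obtain ⟨c, hc⟩ := ENat.ne_top_iff_exists.1 hc
  rw [← hc] at hi ⊢
  rw [Pi.sub_apply]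
  norm_cast at hi ⊢
  omega

/-- The boundary path `f x`, for a boundary path `x` with `r(x) = s(f)`. -/
noncomputable def concat (hlc : Λ.LocallyConvex) (f : Λ.Mor) (x : Λ.BoundaryPath)
    (h : Λ.s f = x.range) : Λ.BoundaryPath where
  deg i := (Λ.d f i : ℕ∞) + x.deg i
  hom := concatHom f x h
  boundary := concat_boundary hlc f x h

end BoundaryPath

/-- The set `V_Λ` of pairs `(x; m)`. -/
structure VRep (Λ : KGraph.{u} k) where
  x : Λ.BoundaryPath
  m : Fin k → ℕ

/-- The set `P_Λ` of pairs `(x; (m, n))` with `m ≤ n`. -/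
structure PRep (Λ : KGraph.{u} k) where
  x : Λ.BoundaryPath
  m : Fin k → ℕ
  n : Fin k → ℕ
  le : m ≤ n

/-- The relation `∼` on `V_Λ`. -/
def vSetoid (Λ : KGraph.{u} k) : Setoid Λ.VRep where
  r a b := a.x.meetVert a.m = b.x.meetVert b.m ∧
    a.m - meet a.m a.x.deg = b.m - meet b.m b.x.deg
  iseqv :=
    { refl := fun _ => ⟨rfl, rfl⟩
      symm := fun h => ⟨h.1.symm, h.2.symm⟩
      trans := fun h h' => ⟨h.1.trans h'.1, h.2.trans h'.2⟩ }

/-- The relation `≈` on `P_Λ`. -/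
def pSetoid (Λ : KGraph.{u} k) : Setoid Λ.PRep where
  r a b := a.x.meetSeg a.m a.n a.le = b.x.meetSeg b.m b.n b.le ∧
    a.m - meet a.m a.x.deg = b.m - meet b.m b.x.deg ∧ a.n - a.m = b.n - b.m
  iseqv :=
    { refl := fun _ => ⟨rfl, rfl, rfl⟩
      symm := fun h => ⟨h.1.symm, h.2.1.symm, h.2.2.symm⟩
      trans := fun h h' => ⟨h.1.trans h'.1, h.2.1.trans h'.2.1, h.2.2.trans h'.2.2⟩ }

namespace Tilde

variable {Λ : KGraph.{u} k}

/-- The vertices `V_Λ / ∼`. -/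
def Obj (Λ : KGraph.{u} k) : Type u := Quotient Λ.vSetoid

/-- The paths `P_Λ / ≈`. -/
def Mor (Λ : KGraph.{u} k) : Type u := Quotient Λ.pSetoid

/-- The class `[x; m]`. -/
def vmk (x : Λ.BoundaryPath) (m : Fin k → ℕ) : Obj Λ := Quotient.mk Λ.vSetoid ⟨x, m⟩

/-- The class `[x; (m, n)]`. -/
def pmk (x : Λ.BoundaryPath) (m n : Fin k → ℕ) (h : m ≤ n) : Mor Λ :=
  Quotient.mk Λ.pSetoid ⟨x, m, n, h⟩

theorem vmk_eq {x y : Λ.BoundaryPath} {m n : Fin k → ℕ} : vmk x m = vmk y n ↔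
    x.meetVert m = y.meetVert n ∧ m - meet m x.deg = n - meet n y.deg := Quotient.eq

theorem pmk_eq {x y : Λ.BoundaryPath} {m n p q : Fin k → ℕ} {h : m ≤ n} {h' : p ≤ q} :
    pmk x m n h = pmk y p q h' ↔ x.meetSeg m n h = y.meetSeg p q h' ∧
      m - meet m x.deg = p - meet p y.deg ∧ n - m = q - p := Quotient.eq

theorem exists_pmk (f : Mor Λ) : ∃ x m n h, f = pmk x m n h := by
  obtain ⟨a, rfl⟩ := Quotient.exists_rep f
  exact ⟨a.x, a.m, a.n, a.le, rfl⟩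

theorem meetSeg_eq {x y : Λ.BoundaryPath} {m n p q : Fin k → ℕ} {h : m ≤ n} {h' : p ≤ q}
    (e : x.meetSeg m n h = y.meetSeg p q h') :
    x.meetVert m = y.meetVert p ∧ x.meetVert n = y.meetVert q ∧
      meet n x.deg - meet m x.deg = meet q y.deg - meet p y.deg := by
  refine ⟨?_, ?_, ?_⟩
  · have := congrArg Λ.r e
    rwa [BoundaryPath.meetSeg, BoundaryPath.meetSeg, BoundaryPath.seg, BoundaryPath.seg,
      OmegaHom.r_seg, OmegaHom.r_seg] at this
  · have := congrArg Λ.s e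
    rwa [BoundaryPath.meetSeg, BoundaryPath.meetSeg, BoundaryPath.seg, BoundaryPath.seg,
      OmegaHom.s_seg, OmegaHom.s_seg] at this
  · have := congrArg Λ.d e
    rwa [BoundaryPath.meetSeg, BoundaryPath.meetSeg, BoundaryPath.seg, BoundaryPath.seg,
      OmegaHom.d_seg, OmegaHom.d_seg] at this

theorem meet_cases (a : ℕ∞) : a = ⊤ ∨ ∃ c : ℕ, a = c := by
  induction a using ENat.recTopCoe with
  | top => exact Or.inl rfl
  | coe c => exact Or.inr ⟨c, rfl⟩

/-- Truncation at an intermediate time does not depend on the representative. -/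
theorem meet_mid {d d' : Fin k → ℕ∞} {m n p q t : Fin k → ℕ} (hmn : m ≤ n) (hpq : p ≤ q)
    (h1 : meet n d - meet m d = meet q d' - meet p d') (h2 : m - meet m d = p - meet p d')
    (h3 : n - m = q - p) (ht : t ≤ n - m) :
    meet (m + t) d - meet m d = meet (p + t) d' - meet p d' ∧
      (m + t) - meet (m + t) d = (p + t) - meet (p + t) d' := by
  have key : ∀ i, (meet (m + t) d - meet m d) i = (meet (p + t) d' - meet p d') i ∧
      ((m + t) - meet (m + t) d) i = ((p + t) - meet (p + t) d') i := by
    intro i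
    have a1 := congrFun h1 i
    have a2 := congrFun h2 i
    have a3 := congrFun h3 i
    have a4 := le_at hmn i
    have a5 := le_at hpq i
    have a6 := le_at ht i
    simp only [Pi.sub_apply, Pi.add_apply] at a1 a2 a3 a6 ⊢
    rcases meet_cases (d i) with e | ⟨c, e⟩ <;> rcases meet_cases (d' i) with e' | ⟨c', e'⟩
    · simp only [meet_apply_top _ d i e, meet_apply_top _ d' i e', Pi.add_apply] at *; omega
    · simp only [meet_apply_top _ d i e, meet_apply_coe _ d' i c' e', Pi.add_apply] at *; omega
    · simp only [meet_apply_coe _ d i c e, meet_apply_top _ d' i e', Pi.add_apply] at *; omega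
    · simp only [meet_apply_coe _ d i c e, meet_apply_coe _ d' i c' e', Pi.add_apply] at *; omega
  exact ⟨funext fun i => (key i).1, funext fun i => (key i).2⟩

/-- `r([x; (m, n)]) = [x; m]`. -/
def range : Mor Λ → Obj Λ :=
  Quotient.lift (fun a : Λ.PRep => vmk a.x a.m) fun _ _ h =>
    vmk_eq.2 ⟨(meetSeg_eq h.1).1, h.2.1⟩

theorem source_aux {x y : Λ.BoundaryPath} {m n p q : Fin k → ℕ} {hmn : m ≤ n} {hpq : p ≤ q}
    (h : pmk x m n hmn = pmk y p q hpq) : vmk x n = vmk y q := by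
  obtain ⟨h1, h2, h3⟩ := pmk_eq.1 h
  obtain ⟨-, h4, h5⟩ := meetSeg_eq h1
  have := (meet_mid hmn hpq h5 h2 h3 le_rfl).2
  rw [add_tsub_cancel_of_le hmn, h3, add_tsub_cancel_of_le hpq] at this
  exact vmk_eq.2 ⟨h4, this⟩

/-- `s([x; (m, n)]) = [x; n]`. -/
def source : Mor Λ → Obj Λ :=
  Quotient.lift (fun a : Λ.PRep => vmk a.x a.n) fun a b h =>
    source_aux (hmn := a.le) (hpq := b.le) (Quotient.sound h)

/-- `id([x; m]) = [x; (m, m)]`. -/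
def ident : Obj Λ → Mor Λ :=
  Quotient.lift (fun a : Λ.VRep => pmk a.x a.m a.m le_rfl) fun a b h => by
    refine pmk_eq.2 ⟨?_, h.2, by rw [tsub_self, tsub_self]⟩
    have e : ∀ (x : Λ.BoundaryPath) (m : Fin k → ℕ),
        x.meetSeg m m le_rfl = Λ.ident (x.meetVert m) := fun x m => x.hom.map_ident ⟨_, _⟩
    rw [e, e, h.1]

/-- `d([x; (m, n)]) = n - m`. -/
def degree : Mor Λ → (Fin k → ℕ) :=
  Quotient.lift (fun a : Λ.PRep => a.n - a.m) fun _ _ h => h.2.2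

theorem range_pmk (x : Λ.BoundaryPath) (m n : Fin k → ℕ) (h : m ≤ n) :
    range (pmk x m n h) = vmk x m := rfl

theorem source_pmk (x : Λ.BoundaryPath) (m n : Fin k → ℕ) (h : m ≤ n) :
    source (pmk x m n h) = vmk x n := rfl

theorem degree_pmk (x : Λ.BoundaryPath) (m n : Fin k → ℕ) (h : m ≤ n) :
    degree (pmk x m n h) = n - m := rfl

/-- The initial segment `x(0, n ∧ d(x))`. -/
noncomputable def initSeg (x : Λ.BoundaryPath) (n : Fin k → ℕ) : Λ.Mor :=
  x.seg 0 (meet n x.deg) zero_le (meet_le_right _ _)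

/-- The tail `σ^{p ∧ d(y)}(y)`. -/
noncomputable def tail (y : Λ.BoundaryPath) (p : Fin k → ℕ) : Λ.BoundaryPath :=
  y.shift (meet p y.deg) (meet_le_right _ _)

theorem glue_aux {x y : Λ.BoundaryPath} {n p : Fin k → ℕ} (h : vmk x n = vmk y p) :
    Λ.s (initSeg x n) = (tail y p).range := by
  rw [tail, BoundaryPath.shift_range, initSeg, BoundaryPath.seg, OmegaHom.s_seg]
  exact (vmk_eq.1 h).1

/-- The boundary path `x(0, n ∧ d(x)) σ^{p ∧ d(y)}(y)`, for `[x; n] = [y; p]`. -/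
noncomputable def glue (hlc : Λ.LocallyConvex) (x y : Λ.BoundaryPath) (n p : Fin k → ℕ)
    (h : vmk x n = vmk y p) : Λ.BoundaryPath :=
  BoundaryPath.concat hlc (initSeg x n) (tail y p) (glue_aux h)

theorem glue_deg (hlc : Λ.LocallyConvex) (x y : Λ.BoundaryPath) (n p : Fin k → ℕ)
    (h : vmk x n = vmk y p) (i : Fin k) :
    (glue hlc x y n p h).deg i = (meet n x.deg i : ℕ∞) + (y.deg i - meet p y.deg i) := by
  change (Λ.d (initSeg x n) i : ℕ∞) + _ = _
  rw [initSeg, BoundaryPath.seg, OmegaHom.d_seg, tsub_zero]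
  rfl

theorem glue_meet_left (hlc : Λ.LocallyConvex) (x y : Λ.BoundaryPath) (n p : Fin k → ℕ)
    (h : vmk x n = vmk y p) (m : Fin k → ℕ) (hm : m ≤ n) :
    meet m (glue hlc x y n p h).deg = meet m x.deg := by
  funext i
  have a1 := congrFun (vmk_eq.1 h).2 i
  have a2 : m i ≤ n i := hm i
  have hd := glue_deg hlc x y n p h i
  simp only [Pi.sub_apply] at a1
  rcases meet_cases (x.deg i) with e | ⟨c, e⟩ <;> rcases meet_cases (y.deg i) with e' | ⟨c', e'⟩
  · rw [e', ENat.top_sub_natCast, add_top] at hd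
    rw [meet_apply_top _ _ _ hd, meet_apply_top _ _ _ e]
  · rw [e', ← ENat.natCast_sub, ← Nat.cast_add] at hd
    simp only [meet_apply_coe _ _ _ _ hd, meet_apply_top _ _ _ e, meet_apply_coe _ _ _ _ e']
      at a1 ⊢
    omega
  · rw [e', ENat.top_sub_natCast, add_top] at hd
    simp only [meet_apply_top _ _ _ hd, meet_apply_coe _ _ _ _ e, meet_apply_top _ _ _ e']
      at a1 ⊢
    omega
  · rw [e', ← ENat.natCast_sub, ← Nat.cast_add] at hd
    simp only [meet_apply_coe _ _ _ _ hd, meet_apply_coe _ _ _ _ e, meet_apply_coe _ _ _ _ e']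
      at a1 ⊢
    omega

theorem glue_meet_right (hlc : Λ.LocallyConvex) (x y : Λ.BoundaryPath) (n p : Fin k → ℕ)
    (h : vmk x n = vmk y p) (q : Fin k → ℕ) (hq : p ≤ q) :
    meet (n + (q - p)) (glue hlc x y n p h).deg =
      meet n x.deg + (meet q y.deg - meet p y.deg) := by
  funext i
  have a1 := congrFun (vmk_eq.1 h).2 i
  have a2 : p i ≤ q i := hq i
  have hd := glue_deg hlc x y n p h i
  simp only [Pi.sub_apply, Pi.add_apply] at a1 ⊢
  rcases meet_cases (x.deg i) with e | ⟨c, e⟩ <;> rcases meet_cases (y.deg i) with e' | ⟨c', e'⟩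
  · rw [e', ENat.top_sub_natCast, add_top] at hd
    simp only [meet_apply_top _ _ _ hd, meet_apply_top _ _ _ e, meet_apply_top _ _ _ e',
      Pi.add_apply, Pi.sub_apply]
  · rw [e', ← ENat.natCast_sub, ← Nat.cast_add] at hd
    simp only [meet_apply_coe _ _ _ _ hd, meet_apply_top _ _ _ e, meet_apply_coe _ _ _ _ e',
      Pi.add_apply, Pi.sub_apply] at a1 ⊢
    omega
  · rw [e', ENat.top_sub_natCast, add_top] at hd
    simp only [meet_apply_top _ _ _ hd, meet_apply_coe _ _ _ _ e, meet_apply_top _ _ _ e',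
      Pi.add_apply, Pi.sub_apply] at a1 ⊢
    omega
  · rw [e', ← ENat.natCast_sub, ← Nat.cast_add] at hd
    simp only [meet_apply_coe _ _ _ _ hd, meet_apply_coe _ _ _ _ e, meet_apply_coe _ _ _ _ e',
      Pi.add_apply, Pi.sub_apply] at a1 ⊢
    omega

theorem glue_meetSeg (hlc : Λ.LocallyConvex) (x y : Λ.BoundaryPath) (m n p q : Fin k → ℕ)
    (hmn : m ≤ n) (hpq : p ≤ q) (h : vmk x n = vmk y p) (hc) :
    (glue hlc x y n p h).meetSeg m (n + (q - p)) (hmn.trans le_self_add) =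
      Λ.comp (x.meetSeg m n hmn) (y.meetSeg p q hpq) hc := by
  have hG := glue_aux h
  have hdi : Λ.d (initSeg x n) = meet n x.deg := by
    rw [initSeg, BoundaryPath.seg, OmegaHom.d_seg, tsub_zero]
  have e1 := glue_meet_left hlc x y n p h m hmn
  have e2 := glue_meet_left hlc x y n p h n le_rfl
  have e3 := glue_meet_right hlc x y n p h q hpq
  have hmono : meet m x.deg ≤ meet n x.deg := meet_mono hmn _
  have hle : meet n x.deg ≤ meet n x.deg + (meet q y.deg - meet p y.deg) := le_self_add
  have hb : ∀ i, ((meet n x.deg + (meet q y.deg - meet p y.deg)) i : ℕ∞) ≤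
      (glue hlc x y n p h).deg i := by
    rw [← e3]; exact meet_le_right _ _
  have s1 : (glue hlc x y n p h).seg (meet m x.deg) (meet n x.deg) hmono
      (le_deg_of_le hle hb) = x.meetSeg m n hmn := by
    refine (BoundaryPath.concatHom_seg_zero (initSeg x n) (tail y p) hG _ _ hmono hdi.ge
      (le_deg_of_le hle hb)).trans ?_
    refine Λ.segment_eq _ _ ⟨x.seg 0 (meet m x.deg) zero_le (le_deg_of_le hmono (meet_le_right _ _)),
      Λ.ident (Λ.s (x.meetSeg m n hmn)), (Λ.r_ident _).symm, ?_, ?_, ?_, ?_⟩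
    · rw [Λ.r_comp]
      exact (x.hom.s_seg _ _ _ _).trans (x.hom.r_seg _ _ _ _).symm
    · exact (x.hom.d_seg _ _ _ _).trans (tsub_zero _)
    · exact x.hom.d_seg _ _ _ _
    · rw [Λ.comp_congr _ rfl (Λ.comp_ident (x.meetSeg m n hmn))]
      exact x.hom.seg_comp _ _ _ _ _ _ _
  have hq0 : ∀ i, (((meet q y.deg - meet p y.deg) i : ℕ) : ℕ∞) ≤ (tail y p).deg i := fun i => by
    change (((meet q y.deg i - meet p y.deg i : ℕ)) : ℕ∞) ≤ y.deg i - (meet p y.deg i : ℕ∞)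
    rw [ENat.natCast_sub]
    exact tsub_le_tsub_right (meet_le_right q y.deg i) _
  have s2 : (glue hlc x y n p h).seg (meet n x.deg)
      (meet n x.deg + (meet q y.deg - meet p y.deg)) hle hb = y.meetSeg p q hpq := by
    have hb' : ∀ i, ((Λ.d (initSeg x n) + (meet q y.deg - meet p y.deg)) i : ℕ∞) ≤
      (glue hlc x y n p h).deg i := by rw [hdi]; exact hb
    have t1 := BoundaryPath.concatHom_seg_d (initSeg x n) (tail y p) hG 0
      (meet q y.deg - meet p y.deg) zero_le hq0 hb'
    have t2 : (glue hlc x y n p h).seg (meet n x.deg)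
        (meet n x.deg + (meet q y.deg - meet p y.deg)) hle hb =
        (BoundaryPath.concatHom (initSeg x n) (tail y p) hG).seg (Λ.d (initSeg x n) + 0)
          (Λ.d (initSeg x n) + (meet q y.deg - meet p y.deg)) (add_le_add_right zero_le _) hb' :=
      OmegaHom.seg_congr _ _ _ (by rw [hdi, add_zero]) (by rw [hdi])
    refine t2.trans (t1.trans ?_)
    exact y.hom.seg_congr _ _ (zero_add _) (tsub_add_cancel_of_le (meet_mono hpq _))
  have s3 : (glue hlc x y n p h).meetSeg m (n + (q - p)) (hmn.trans le_self_add) =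
      (glue hlc x y n p h).seg (meet m x.deg) (meet n x.deg + (meet q y.deg - meet p y.deg))
        (hmono.trans hle) hb := OmegaHom.seg_congr _ _ _ e1 e3
  rw [s3]
  refine Eq.trans ?_ (Λ.comp_congr (by rw [s1, s2, hc]) s1 s2)
  exact (OmegaHom.seg_comp _ _ _ _ _ _ _ _).symm

/-- `[x; (m, n)] ∘ [y; (p, q)] = [x(0, n ∧ d(x)) σ^{p ∧ d(y)}(y); (m, n + q - p)]`, computed with
chosen representatives; `comp_pmk` shows that the formula holds for all representatives. -/
noncomputable def comp (hlc : Λ.LocallyConvex) (f g : Mor Λ) (h : source f = range g) : Mor Λ :=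
  pmk (glue hlc (Quotient.out f).x (Quotient.out g).x (Quotient.out f).n (Quotient.out g).m
    (by
      have hf : pmk _ _ _ (Quotient.out f).le = f := Quotient.out_eq f
      have hg : pmk _ _ _ (Quotient.out g).le = g := Quotient.out_eq g
      rw [← hf, ← hg] at h
      exact h))
    (Quotient.out f).m ((Quotient.out f).n + ((Quotient.out g).n - (Quotient.out g).m))
    ((Quotient.out f).le.trans le_self_add)

theorem meetSeg_comp_aux {x y : Λ.BoundaryPath} {m n p q : Fin k → ℕ} (hmn : m ≤ n)
    (hpq : p ≤ q) (h : vmk x n = vmk y p) :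
    Λ.s (x.meetSeg m n hmn) = Λ.r (y.meetSeg p q hpq) :=
  (x.hom.s_seg _ _ _ _).trans ((vmk_eq.1 h).1.trans (y.hom.r_seg _ _ _ _).symm)

theorem glue_pmk (hlc : Λ.LocallyConvex) (x y z : Λ.BoundaryPath) (m n p q a b : Fin k → ℕ)
    (hmn : m ≤ n) (hpq : p ≤ q) (hab : a ≤ b) (h : vmk x n = vmk y p) :
    pmk (glue hlc x y n p h) m (n + (q - p)) (hmn.trans le_self_add) = pmk z a b hab ↔
      Λ.comp (x.meetSeg m n hmn) (y.meetSeg p q hpq) (meetSeg_comp_aux hmn hpq h) =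
        z.meetSeg a b hab ∧ m - meet m x.deg = a - meet a z.deg ∧
        (n - m) + (q - p) = b - a := by
  rw [pmk_eq, glue_meetSeg hlc x y m n p q hmn hpq h (meetSeg_comp_aux hmn hpq h),
    glue_meet_left hlc x y n p h m hmn, tsub_add_eq_add_tsub hmn]

theorem comp_pmk (hlc : Λ.LocallyConvex) (x y : Λ.BoundaryPath) (m n p q : Fin k → ℕ)
    (hmn : m ≤ n) (hpq : p ≤ q) (h : vmk x n = vmk y p) :
    comp hlc (pmk x m n hmn) (pmk y p q hpq) h =
      pmk (glue hlc x y n p h) m (n + (q - p)) (hmn.trans le_self_add) := by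
  have hf : pmk _ _ _ (Quotient.out (pmk x m n hmn)).le = pmk x m n hmn := Quotient.out_eq _
  have hg : pmk _ _ _ (Quotient.out (pmk y p q hpq)).le = pmk y p q hpq := Quotient.out_eq _
  obtain ⟨f1, f2, f3⟩ := pmk_eq.1 hf
  obtain ⟨g1, g2, g3⟩ := pmk_eq.1 hg
  refine (glue_pmk hlc _ _ _ _ _ _ _ _ _ (Quotient.out (pmk x m n hmn)).le
    (Quotient.out (pmk y p q hpq)).le _ _).2 ?_
  rw [glue_meetSeg hlc x y m n p q hmn hpq h (meetSeg_comp_aux hmn hpq h),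
    glue_meet_left hlc x y n p h m hmn]
  refine ⟨Λ.comp_congr _ f1 g1, f2, ?_⟩
  rw [f3, g3, tsub_add_eq_add_tsub hmn]

/-- The projection `π`: `[x; (m, n)] ↦ x(m ∧ d(x), n ∧ d(x))`, from paths of `Λ̃` to paths of `Λ`
(here `Λ` is identified with its copy in `Λ̃`). -/
noncomputable def proj : Mor Λ → Λ.Mor :=
  Quotient.lift (fun a : Λ.PRep => a.x.meetSeg a.m a.n a.le) fun _ _ h => h.1

/-- The excess `m - m ∧ d(x)` of `[x; (m, n)]`. -/
noncomputable def excess : Mor Λ → (Fin k → ℕ) :=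
  Quotient.lift (fun a : Λ.PRep => a.m - meet a.m a.x.deg) fun _ _ h => h.2.1

theorem mor_ext {f g : Mor Λ} (h1 : proj f = proj g) (h2 : excess f = excess g)
    (h3 : degree f = degree g) : f = g := by
  obtain ⟨x, m, n, hmn, rfl⟩ := exists_pmk f
  obtain ⟨y, p, q, hpq, rfl⟩ := exists_pmk g
  exact pmk_eq.2 ⟨h1, h2, h3⟩

theorem proj_pmk (x : Λ.BoundaryPath) (m n : Fin k → ℕ) (h : m ≤ n) :
    proj (pmk x m n h) = x.meetSeg m n h := rfl

theorem excess_pmk (x : Λ.BoundaryPath) (m n : Fin k → ℕ) (h : m ≤ n) :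
    excess (pmk x m n h) = m - meet m x.deg := rfl

theorem s_proj {f g : Mor Λ} (h : source f = range g) : Λ.s (proj f) = Λ.r (proj g) := by
  obtain ⟨x, m, n, hmn, rfl⟩ := exists_pmk f
  obtain ⟨y, p, q, hpq, rfl⟩ := exists_pmk g
  exact meetSeg_comp_aux hmn hpq h

theorem comp_invariants (hlc : Λ.LocallyConvex) (f g : Mor Λ) (h : source f = range g) :
    proj (comp hlc f g h) = Λ.comp (proj f) (proj g) (s_proj h) ∧
      excess (comp hlc f g h) = excess f ∧ degree (comp hlc f g h) = degree f + degree g ∧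
      range (comp hlc f g h) = range f ∧ source (comp hlc f g h) = source g := by
  obtain ⟨x, m, n, hmn, rfl⟩ := exists_pmk f
  obtain ⟨y, p, q, hpq, rfl⟩ := exists_pmk g
  have h' : vmk x n = vmk y p := h
  have c1 := glue_meetSeg hlc x y m n p q hmn hpq h' (meetSeg_comp_aux hmn hpq h')
  have c2 := glue_meet_left hlc x y n p h' m hmn
  have c3 := glue_meet_right hlc x y n p h' q hpq
  rw [comp_pmk hlc x y m n p q hmn hpq h']
  refine ⟨c1, by rw [excess_pmk, excess_pmk, c2], ?_, ?_, ?_⟩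
  · rw [degree_pmk, degree_pmk, degree_pmk, tsub_add_eq_add_tsub hmn]
  · rw [range_pmk, range_pmk, vmk_eq, c2]
    refine ⟨?_, rfl⟩
    have := congrArg Λ.r c1
    rw [Λ.r_comp] at this
    exact ((OmegaHom.r_seg _ _ _ _ _).symm.trans this).trans (OmegaHom.r_seg _ _ _ _ _)
  · rw [source_pmk, source_pmk, vmk_eq, c3]
    constructor
    · have := congrArg Λ.s c1
      rw [Λ.s_comp] at this
      exact ((OmegaHom.s_seg _ _ _ _ _).symm.trans this).trans (OmegaHom.s_seg _ _ _ _ _)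
    · funext i
      have a1 := congrFun (vmk_eq.1 h').2 i
      have a2 := le_at hpq i
      have a3 := le_at (meet_mono hpq y.deg) i
      have a4 := le_at (meet_le_left n x.deg) i
      have a5 := le_at (meet_le_left p y.deg) i
      have a6 := le_at (meet_le_left q y.deg) i
      simp only [Pi.sub_apply, Pi.add_apply] at a1 ⊢
      omega

theorem range_ident (v : Obj Λ) : range (ident v) = v := by
  obtain ⟨a, rfl⟩ := Quotient.exists_rep v
  rfl

theorem source_ident (v : Obj Λ) : source (ident v) = v := by
  obtain ⟨a, rfl⟩ := Quotient.exists_rep v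
  rfl

theorem degree_ident (v : Obj Λ) : degree (ident v) = 0 := by
  obtain ⟨a, rfl⟩ := Quotient.exists_rep v
  exact tsub_self a.m

theorem ident_invariants (x : Λ.BoundaryPath) (m : Fin k → ℕ) :
    proj (ident (vmk x m)) = Λ.ident (x.meetVert m) ∧
      excess (ident (vmk x m)) = m - meet m x.deg :=
  ⟨x.hom.map_ident ⟨_, _⟩, rfl⟩

theorem ident_comp (hlc : Λ.LocallyConvex) (f : Mor Λ) :
    comp hlc (ident (range f)) f (source_ident _) = f := by
  obtain ⟨c1, c2, c3, -⟩ := comp_invariants hlc (ident (range f)) f (source_ident _)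
  refine mor_ext (c1.trans ?_) (c2.trans ?_) (by rw [c3, degree_ident, zero_add])
  · have e : proj (ident (range f)) = Λ.ident (Λ.r (proj f)) := by
      obtain ⟨x, m, n, hmn, rfl⟩ := exists_pmk f
      rw [range_pmk, (ident_invariants x m).1, proj_pmk]
      exact congrArg Λ.ident (x.hom.r_seg _ _ _ _).symm
    rw [Λ.comp_congr _ e rfl, Λ.ident_comp]
  · obtain ⟨x, m, n, hmn, rfl⟩ := exists_pmk f
    rfl

theorem comp_ident (hlc : Λ.LocallyConvex) (f : Mor Λ) :
    comp hlc f (ident (source f)) (range_ident _).symm = f := by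
  obtain ⟨c1, c2, c3, -⟩ := comp_invariants hlc f (ident (source f)) (range_ident _).symm
  refine mor_ext (c1.trans ?_) c2 (by rw [c3, degree_ident, add_zero])
  have e : proj (ident (source f)) = Λ.ident (Λ.s (proj f)) := by
    obtain ⟨x, m, n, hmn, rfl⟩ := exists_pmk f
    rw [source_pmk, (ident_invariants x n).1, proj_pmk]
    exact congrArg Λ.ident (x.hom.s_seg _ _ _ _).symm
  rw [Λ.comp_congr _ rfl e, Λ.comp_ident]

theorem assoc (hlc : Λ.LocallyConvex) (f g h : Mor Λ) (hfg : source f = range g)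
    (hgh : source g = range h) (h1 : source (comp hlc f g hfg) = range h)
    (h2 : source f = range (comp hlc g h hgh)) :
    comp hlc (comp hlc f g hfg) h h1 = comp hlc f (comp hlc g h hgh) h2 := by
  obtain ⟨a1, a2, a3, -⟩ := comp_invariants hlc _ h h1
  obtain ⟨b1, b2, b3, -⟩ := comp_invariants hlc f _ h2
  obtain ⟨c1, c2, c3, -⟩ := comp_invariants hlc f g hfg
  obtain ⟨d1, d2, d3, -⟩ := comp_invariants hlc g h hgh
  refine mor_ext ?_ (by rw [a2, b2, c2]) (by rw [a3, b3, c3, d3, add_assoc])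
  rw [a1, b1, Λ.comp_congr _ c1 rfl, Λ.comp_congr (f := proj f) _ rfl d1]
  exact Λ.assoc _ _ _ (s_proj hfg) (s_proj hgh)

theorem comp_same (hlc : Λ.LocallyConvex) (x : Λ.BoundaryPath) (m n t : Fin k → ℕ)
    (hmn : m ≤ n) (hnt : n ≤ t) (h : source (pmk x m n hmn) = range (pmk x n t hnt)) :
    comp hlc (pmk x m n hmn) (pmk x n t hnt) h = pmk x m t (hmn.trans hnt) := by
  obtain ⟨c1, c2, c3, -⟩ := comp_invariants hlc (pmk x m n hmn) (pmk x n t hnt) h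
  refine mor_ext (c1.trans (x.hom.seg_comp _ _ _ _ _ _ _)) c2 (c3.trans ?_)
  rw [degree_pmk, degree_pmk, degree_pmk]
  funext i
  have h1 := le_at hmn i
  have h2 := le_at hnt i
  simp only [Pi.add_apply, Pi.sub_apply]; omega

/-- The degree of `π(f)` and the excess at the source, in terms of representatives. -/
theorem d_proj_le (f : Mor Λ) (i : Fin k) : Λ.d (proj f) i ≤ degree f i ∧
    (excess f i ≠ 0 → Λ.d (proj f) i = 0) := by
  obtain ⟨x, m, n, hmn, rfl⟩ := exists_pmk f
  have hd : Λ.d (proj (pmk x m n hmn)) = meet n x.deg - meet m x.deg := x.hom.d_seg _ _ _ _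
  rw [hd, degree_pmk, excess_pmk]
  have h1 := le_at hmn i
  simp only [Pi.sub_apply]
  rcases meet_cases (x.deg i) with e | ⟨c, e⟩
  · simp only [meet_apply_top _ _ _ e]; omega
  · simp only [meet_apply_coe _ _ _ _ e]; omega

theorem excess_of_composable {f g : Mor Λ} (h : source f = range g) (i : Fin k) :
    excess g i + Λ.d (proj f) i = excess f i + degree f i := by
  obtain ⟨x, m, n, hmn, rfl⟩ := exists_pmk f
  obtain ⟨y, p, q, hpq, rfl⟩ := exists_pmk g
  have a1 := congrFun (vmk_eq.1 (show vmk x n = vmk y p from h)).2 i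
  have hd : Λ.d (proj (pmk x m n hmn)) = meet n x.deg - meet m x.deg := x.hom.d_seg _ _ _ _
  rw [hd, degree_pmk, excess_pmk, excess_pmk]
  simp only [Pi.sub_apply] at a1 ⊢
  have h1 := le_at hmn i
  have a3 := le_at (meet_mono hmn x.deg) i
  have a4 := le_at (meet_le_left n x.deg) i
  have a5 := le_at (meet_le_left m x.deg) i
  omega

theorem comp_inj (hlc : Λ.LocallyConvex) {f g f' g' : Mor Λ} (h : source f = range g)
    (h' : source f' = range g') (hc : comp hlc f g h = comp hlc f' g' h')
    (hf : degree f = degree f') (hg : degree g = degree g') : f = f' ∧ g = g' := by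
  obtain ⟨c1, c2, c3, -⟩ := comp_invariants hlc f g h
  obtain ⟨d1, d2, d3, -⟩ := comp_invariants hlc f' g' h'
  have e1 := c1.symm.trans ((congrArg proj hc).trans d1)
  have e2 := c2.symm.trans ((congrArg excess hc).trans d2)
  have e4 : Λ.d (proj f) = Λ.d (proj f') := by
    funext i
    have a0 := congrFun (congrArg Λ.d e1) i
    rw [Λ.d_comp, Λ.d_comp] at a0
    simp only [Pi.add_apply] at a0
    have a1 := d_proj_le f i
    have a2 := d_proj_le f' i
    have a3 := d_proj_le g i
    have a4 := d_proj_le g' i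
    have a5 := excess_of_composable h i
    have a6 := excess_of_composable h' i
    have a7 := congrFun e2 i
    have a8 := congrFun hf i
    omega
  obtain ⟨e5, e6⟩ := Λ.factor_unique _ _ e1 e4
  refine ⟨mor_ext e5 e2 hf, mor_ext e6 ?_ hg⟩
  funext i
  have a5 := excess_of_composable h i
  have a6 := excess_of_composable h' i
  have a7 := congrFun e2 i
  have a8 := congrFun hf i
  have a9 := congrFun e4 i
  omega

theorem factorisation (hlc : Λ.LocallyConvex) (f : Mor Λ) (a b : Fin k → ℕ)
    (hab : degree f = a + b) :
    ∃! p : {p : Mor Λ × Mor Λ // source p.1 = range p.2},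
      degree p.1.1 = a ∧ degree p.1.2 = b ∧ comp hlc p.1.1 p.1.2 p.2 = f := by
  obtain ⟨x, m, n, hmn, rfl⟩ := exists_pmk f
  have hn : n = m + a + b := by
    rw [degree_pmk] at hab
    rw [add_assoc, ← hab, add_tsub_cancel_of_le hmn]
  subst hn
  refine ⟨⟨(pmk x m (m + a) le_self_add, pmk x (m + a) (m + a + b) le_self_add), rfl⟩,
    ⟨add_tsub_cancel_left _ _, add_tsub_cancel_left _ _, comp_same hlc x _ _ _ _ _ _⟩, ?_⟩
  rintro ⟨⟨g, h⟩, hgh⟩ ⟨h1, h2, h3⟩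
  obtain ⟨e1, e2⟩ := comp_inj hlc hgh rfl
    (h3.trans (comp_same hlc x m (m + a) (m + a + b) le_self_add le_self_add rfl).symm)
    (h1.trans (add_tsub_cancel_left _ _).symm) (h2.trans (add_tsub_cancel_left _ _).symm)
  exact Subtype.ext (Prod.ext e1 e2)

end Tilde

/-- The `k`-graph `Λ̃` obtained from a locally convex `k`-graph `Λ` by removing sources. -/
noncomputable def tilde (Λ : KGraph.{u} k) (hlc : Λ.LocallyConvex) : KGraph.{u} k where
  Obj := Tilde.Obj Λ
  Mor := Tilde.Mor Λ
  r := Tilde.range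
  s := Tilde.source
  ident := Tilde.ident
  comp := Tilde.comp hlc
  r_ident := Tilde.range_ident
  s_ident := Tilde.source_ident
  r_comp f g h := (Tilde.comp_invariants hlc f g h).2.2.2.1
  s_comp f g h := (Tilde.comp_invariants hlc f g h).2.2.2.2
  ident_comp := Tilde.ident_comp hlc
  comp_ident := Tilde.comp_ident hlc
  assoc f g h hfg hgh := Tilde.assoc hlc f g h hfg hgh _ _
  countable := by
    have := Λ.countable
    have hinj : Function.Injective
        (fun f : Tilde.Mor Λ => (Tilde.proj f, Tilde.excess f, Tilde.degree f)) := by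
      intro f g h
      simp only [Prod.mk.injEq] at h
      exact Tilde.mor_ext h.1 h.2.1 h.2.2
    exact hinj.countable
  d := Tilde.degree
  d_ident := Tilde.degree_ident
  d_comp f g h := (Tilde.comp_invariants hlc f g h).2.2.1
  factorisation := Tilde.factorisation hlc

/-- The infinite path `[x; (n, ∞)]` of `Λ̃`, given by `(p, q) ↦ [x; (n + p, n + q)]`. -/
noncomputable def BoundaryPath.toInfinite {Λ : KGraph.{u} k} (hlc : Λ.LocallyConvex)
    (x : Λ.BoundaryPath) (n : Fin k → ℕ) : (Λ.tilde hlc).InfinitePath :=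
  OmegaHom.ofMap (fun f => Tilde.pmk x (n + f.p) (n + f.q) (add_le_add_right f.le n))
    (fun f => (Tilde.degree_pmk _ _ _ _).trans (add_tsub_add_eq_tsub_left n f.q f.p))
    (fun p q t hpq hqt _ => ⟨rfl, Tilde.comp_same hlc x (n + p) (n + q) (n + t)
      (add_le_add_right hpq n) (add_le_add_right hqt n) rfl⟩)

end KGraph

/-!
An infinite path `y` of `Λ̃` is determined by three pieces of data: the projections `π(y(m, n))`,
which are paths of `Λ`, the degrees `n - m`, and the excesses of the vertices `y(m)`
(`KGraph.Tilde.mor_ext`). The excesses are governed by the degree `c(n)` of `π(y(0, n))`: the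
excess at `y(n)` is `a + n - c(n)`, where `a` is the excess at `y(0)`
(`KGraph.InfinitePath.excess_path_add`).

The coordinate `c(n)_i` depends only on `n_i`, never exceeds `n_i`, and stops growing for good as
soon as it falls short of `n_i`, or from the start if `a_i ≠ 0`: a path of `Λ̃` whose range has
positive excess in direction `i` projects to a path of degree `0` in direction `i`. Hence
`c(n) = n ∧ d` for `d = sup c ∈ (ℕ ∪ {∞})^k` (`KGraph.InfinitePath.baseDegree_eq_meet`), and
`a ∧ d = 0`. The required boundary path is the restriction of `(m, n) ↦ π(y(m, n))` to `Ω_{k,d}`.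
It is a boundary path because a vertex with positive excess in direction `i` projects to a vertex of
`Λ` that receives no edge of degree `e_i` (`KGraph.Tilde.not_hasEdge_of_excess_ne_zero`).

That `y` is the infinite path defined by this boundary path and `a`, and the formula for
`π(y(m, n))`, come from the fact that `π(y(m ∧ d, m))` has degree `c(m) - c(m ∧ d) = 0`, hence is an
identity, so that `π(y(m, n)) = π(y(m ∧ d, n ∧ d))`. For uniqueness, a pair `(x, p)` with
`p ∧ d(x) = 0` and `y = [x; (p, ∞)]` has `p = a`, `n ∧ d(x) = c(n)` for all `n`, and
`x(m, n) = π(y(m, n))` for `n ≤ d(x)`.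
-/

namespace KGraph

variable {k : ℕ} {Λ : KGraph.{u} k} {hlc : Λ.LocallyConvex}

theorem meet_eq_self {m : Fin k → ℕ} {d : Fin k → ℕ∞} (h : ∀ i, (m i : ℕ∞) ≤ d i) :
    meet m d = m := by
  funext i
  have := coe_meet m d i
  rw [min_eq_left (h i)] at this
  exact_mod_cast this

theorem meet_add_of_meet_eq_zero {p : Fin k → ℕ} {d : Fin k → ℕ∞} (h : meet p d = 0)
    (m : Fin k → ℕ) : meet (p + m) d = meet m d := by
  funext i
  have h0 : meet p d i = 0 := congrFun h i
  rcases Tilde.meet_cases (d i) with e | ⟨c, e⟩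
  · rw [meet_apply_top _ _ _ e] at h0 ⊢
    rw [meet_apply_top _ _ _ e, Pi.add_apply, h0, zero_add]
  · rw [meet_apply_coe _ _ _ _ e] at h0 ⊢
    rw [meet_apply_coe _ _ _ _ e, Pi.add_apply]
    omega

theorem eq_of_forall_meet_eq {d d' : Fin k → ℕ∞} (h : ∀ n, meet n d = meet n d') : d = d' := by
  have le : ∀ {d d' : Fin k → ℕ∞}, (∀ n, meet n d = meet n d') → ∀ i, d i ≤ d' i := by
    intro d d' h i
    refine ENat.forall_natCast_le_iff_le.1 fun t ht => ?_
    have e := coe_meet (fun _ => t) d i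
    rw [h, coe_meet, min_eq_left ht] at e
    exact min_eq_left_iff.1 e
  exact funext fun i => le_antisymm (le h i) (le (fun n => (h n).symm) i)

theorem comp_of_d_eq_zero_left (Λ : KGraph.{u} k) {f g : Λ.Mor} (h : Λ.s f = Λ.r g)
    (hf : Λ.d f = 0) : Λ.comp f g h = g := by
  have e := Λ.eq_ident_of_d hf
  have hr : Λ.r f = Λ.r g := by rw [← h, e, Λ.s_ident, Λ.r_ident]
  rw [Λ.comp_congr h (e.trans (congrArg Λ.ident hr)) rfl, Λ.ident_comp]

theorem comp_of_d_eq_zero_right (Λ : KGraph.{u} k) {f g : Λ.Mor} (h : Λ.s f = Λ.r g)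
    (hg : Λ.d g = 0) : Λ.comp f g h = f := by
  rw [Λ.comp_congr h rfl ((Λ.eq_ident_of_d hg).trans (congrArg Λ.ident h.symm)), Λ.comp_ident]

namespace BoundaryPath

theorem ext_seg {x y : Λ.BoundaryPath} (hd : x.deg = y.deg)
    (h : ∀ p q hpq hq hq', x.seg p q hpq hq = y.seg p q hpq hq') : x = y := by
  obtain ⟨d, f, _⟩ := x
  obtain ⟨d', g, _⟩ := y
  obtain rfl : d = d' := hd
  obtain rfl : f = g := OmegaHom.ext_seg fun p q hpq hq => h p q hpq hq hq
  rfl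

end BoundaryPath

/-- A vertex `[x; m]` with `m_i > d(x)_i` projects to `x(m ∧ d(x))`, where the boundary condition
for `x` applies in direction `i`. -/
theorem Tilde.not_hasEdge_of_excess_ne_zero (f : Tilde.Mor Λ) (i : Fin k)
    (h : Tilde.excess f i ≠ 0) : ¬ Λ.HasEdge (Λ.r (Tilde.proj f)) i := by
  obtain ⟨x, m, n, hmn, rfl⟩ := Tilde.exists_pmk f
  have e : Λ.r (Tilde.proj (Tilde.pmk x m n hmn)) =
      x.hom.vert (meet m x.deg) (meet_le_right _ _) := x.hom.r_seg _ _ _ _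
  rw [e]
  refine x.boundary _ _ i ?_
  rw [Tilde.excess_pmk, Pi.sub_apply] at h
  rcases Tilde.meet_cases (x.deg i) with e | ⟨c, e⟩
  · rw [meet_apply_top _ _ _ e, tsub_self] at h
    exact absurd rfl h
  · rw [meet_apply_coe _ _ _ _ e] at h ⊢
    rw [e]
    norm_cast
    omega

namespace InfinitePath

/-! ### Projections and excesses of the segments of an infinite path -/

/-- The path `π(y(m, n))` of `Λ`. -/
noncomputable def base (y : (Λ.tilde hlc).InfinitePath) (m n : Fin k → ℕ) (h : m ≤ n) : Λ.Mor :=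
  Tilde.proj (y.path m n h)

/-- The excess of the vertex `y(0)`. -/
noncomputable def startExcess (y : (Λ.tilde hlc).InfinitePath) : Fin k → ℕ :=
  Tilde.excess (y.path 0 0 le_rfl)

/-- The degree of `π(y(0, n))`. -/
noncomputable def baseDegree (y : (Λ.tilde hlc).InfinitePath) (n : Fin k → ℕ) : Fin k → ℕ :=
  Λ.d (y.base 0 n zero_le)

variable (y : (Λ.tilde hlc).InfinitePath)

theorem source_path_eq_range_path (m n t : Fin k → ℕ) (hmn : m ≤ n) (hnt : n ≤ t) :
    Tilde.source (y.path m n hmn) = Tilde.range (y.path n t hnt) :=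
  (OmegaHom.s_seg y _ _ _ _).trans (OmegaHom.r_seg y _ _ _ _).symm

theorem tilde_comp_path (m n t : Fin k → ℕ) (hmn : m ≤ n) (hnt : n ≤ t) :
    Tilde.comp hlc (y.path m n hmn) (y.path n t hnt) (y.source_path_eq_range_path m n t hmn hnt) =
      y.path m t (hmn.trans hnt) :=
  OmegaHom.seg_comp y m n t hmn hnt (fun _ => le_top) (y.source_path_eq_range_path m n t hmn hnt)

theorem degree_path (m n : Fin k → ℕ) (h : m ≤ n) : Tilde.degree (y.path m n h) = n - m :=
  OmegaHom.d_seg y _ _ _ _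

theorem base_comp (m n t : Fin k → ℕ) (hmn : m ≤ n) (hnt : n ≤ t) :
    ∃ h : Λ.s (y.base m n hmn) = Λ.r (y.base n t hnt),
      Λ.comp _ _ h = y.base m t (hmn.trans hnt) :=
  ⟨Tilde.s_proj (y.source_path_eq_range_path m n t hmn hnt),
    (Tilde.comp_invariants hlc _ _ _).1.symm.trans
      (congrArg Tilde.proj (y.tilde_comp_path m n t hmn hnt))⟩

theorem d_base_add (m n : Fin k → ℕ) (h : m ≤ n) :
    y.baseDegree m + Λ.d (y.base m n h) = y.baseDegree n := by
  obtain ⟨h1, h2⟩ := y.base_comp 0 m n zero_le h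
  rw [baseDegree, baseDegree, ← h2, Λ.d_comp]

theorem excess_path_zero (n : Fin k → ℕ) :
    Tilde.excess (y.path 0 n zero_le) = y.startExcess := by
  rw [← y.tilde_comp_path 0 0 n le_rfl zero_le]
  exact (Tilde.comp_invariants hlc _ _ _).2.1

theorem excess_path_add (m n : Fin k → ℕ) (h : m ≤ n) (i : Fin k) :
    Tilde.excess (y.path m n h) i + y.baseDegree m i = y.startExcess i + m i := by
  have := Tilde.excess_of_composable (y.source_path_eq_range_path 0 m n zero_le h) i
  rwa [excess_path_zero, degree_path, tsub_zero] at this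

theorem d_base_le (m n : Fin k → ℕ) (h : m ≤ n) (i : Fin k) :
    Λ.d (y.base m n h) i ≤ n i - m i := by
  have := (Tilde.d_proj_le (y.path m n h) i).1
  rwa [degree_path] at this

theorem baseDegree_le (n : Fin k → ℕ) : y.baseDegree n ≤ n := fun i => y.d_base_le 0 n _ i

/-! ### The degree of the boundary path -/

/-- The coordinate `c(n)_i` depends only on `n_i`, and monotonically so. -/
theorem baseDegree_le_of_le {m n : Fin k → ℕ} {i : Fin k} (h : m i ≤ n i) :
    y.baseDegree m i ≤ y.baseDegree n i := by
  have h1 := congrFun (y.d_base_add m (m ⊔ n) le_sup_left) i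
  have h2 := congrFun (y.d_base_add n (m ⊔ n) le_sup_right) i
  have h3 := y.d_base_le n (m ⊔ n) le_sup_right i
  rw [Pi.sup_apply, sup_eq_right.2 h, tsub_self] at h3
  rw [Pi.add_apply] at h1 h2
  omega

/-- Once `c(n)_i` falls short of `n_i`, the excess at `y(n)` is positive in direction `i`, and
`c_i` does not grow any more. -/
theorem baseDegree_le_of_lt {n : Fin k → ℕ} {i : Fin k} (h : y.baseDegree n i < n i)
    (m : Fin k → ℕ) : y.baseDegree m i ≤ y.baseDegree n i := by
  have h1 := congrFun (y.d_base_add n (m ⊔ n) le_sup_right) i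
  have h2 := y.excess_path_add n (m ⊔ n) le_sup_right i
  have h3 : Λ.d (y.base n (m ⊔ n) le_sup_right) i = 0 :=
    (Tilde.d_proj_le (y.path n (m ⊔ n) le_sup_right) i).2 (by omega)
  have h4 : y.baseDegree m i ≤ y.baseDegree (m ⊔ n) i := y.baseDegree_le_of_le le_sup_left
  rw [Pi.add_apply] at h1
  omega

/-- The degree of the boundary path `π(y)`: the supremum of the degrees of the `π(y(0, n))`. -/
noncomputable def boundaryDegree (i : Fin k) : ℕ∞ := ⨆ n : Fin k → ℕ, (y.baseDegree n i : ℕ∞)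

theorem baseDegree_le_boundaryDegree (n : Fin k → ℕ) (i : Fin k) :
    (y.baseDegree n i : ℕ∞) ≤ y.boundaryDegree i :=
  le_iSup (fun n : Fin k → ℕ => (y.baseDegree n i : ℕ∞)) n

theorem baseDegree_eq_meet (n : Fin k → ℕ) : y.baseDegree n = meet n y.boundaryDegree := by
  funext i
  have key : (y.baseDegree n i : ℕ∞) = min (n i : ℕ∞) (y.boundaryDegree i) := by
    refine le_antisymm
      (le_min (Nat.cast_le.2 (y.baseDegree_le n i)) (y.baseDegree_le_boundaryDegree n i)) ?_
    rcases (y.baseDegree_le n i).eq_or_lt with h | h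
    · rw [h]; exact min_le_left _ _
    · exact (min_le_right _ _).trans
        (iSup_le fun m => Nat.cast_le.2 (y.baseDegree_le_of_lt h m))
  rw [← coe_meet] at key
  exact_mod_cast key

theorem baseDegree_eq_self {n : Fin k → ℕ} (h : ∀ i, (n i : ℕ∞) ≤ y.boundaryDegree i) :
    y.baseDegree n = n := by
  rw [baseDegree_eq_meet, meet_eq_self h]

theorem meet_startExcess : meet y.startExcess y.boundaryDegree = 0 := by
  rw [← baseDegree_eq_meet]
  funext i
  by_cases h : y.startExcess i = 0
  · exact Nat.eq_zero_of_le_zero (h ▸ y.baseDegree_le y.startExcess i)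
  · refine (Tilde.d_proj_le (y.path 0 y.startExcess zero_le) i).2 ?_
    rwa [excess_path_zero]

/-! ### The boundary path -/

theorem d_base_of_le (p q : Fin k → ℕ) (hpq : p ≤ q)
    (hq : ∀ i, (q i : ℕ∞) ≤ y.boundaryDegree i) : Λ.d (y.base p q hpq) = q - p := by
  have h := y.d_base_add p q hpq
  rw [y.baseDegree_eq_self hq, y.baseDegree_eq_self (le_deg_of_le hpq hq)] at h
  exact (tsub_eq_of_eq_add_rev h.symm).symm

theorem d_base_eq_zero {m n : Fin k → ℕ} (h : m ≤ n) (he : y.baseDegree m = y.baseDegree n) :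
    Λ.d (y.base m n h) = 0 :=
  left_eq_add.1 (he.trans (y.d_base_add m n h).symm)

theorem base_congr_left {m n : Fin k → ℕ} (hmn : m ≤ n) (he : y.baseDegree m = y.baseDegree n)
    {t : Fin k → ℕ} (hnt : n ≤ t) : y.base m t (hmn.trans hnt) = y.base n t hnt := by
  obtain ⟨h1, h2⟩ := y.base_comp m n t hmn hnt
  rw [← h2, Λ.comp_of_d_eq_zero_left h1 (y.d_base_eq_zero hmn he)]

theorem base_congr_right {n t : Fin k → ℕ} (hnt : n ≤ t) (he : y.baseDegree n = y.baseDegree t)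
    {m : Fin k → ℕ} (hmn : m ≤ n) : y.base m t (hmn.trans hnt) = y.base m n hmn := by
  obtain ⟨h1, h2⟩ := y.base_comp m n t hmn hnt
  rw [← h2, Λ.comp_of_d_eq_zero_right h1 (y.d_base_eq_zero hnt he)]

/-- At a vertex where the boundary degree is attained in direction `i`, moving `y` by `e_i` does
not change the projection but makes the excess positive. -/
theorem not_hasEdge_of_eq_boundaryDegree (p : Fin k → ℕ)
    (hp : ∀ i, (p i : ℕ∞) ≤ y.boundaryDegree i) (i : Fin k)
    (hi : (p i : ℕ∞) = y.boundaryDegree i) : ¬ Λ.HasEdge (Λ.r (y.base p p le_rfl)) i := by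
  have hle : p ≤ p + Pi.single i 1 := le_self_add
  have hmeet : meet (p + Pi.single i 1) y.boundaryDegree = p := by
    refine le_antisymm (fun j => ?_) ((meet_eq_self hp).ge.trans (meet_mono hle _))
    by_cases hj : j = i
    · subst hj
      have := meet_le_right (p + Pi.single j 1) y.boundaryDegree j
      rw [← hi] at this
      exact_mod_cast this
    · have := meet_le_left (p + Pi.single i 1) y.boundaryDegree j
      simpa [hj] using this
  have hc : y.baseDegree p = y.baseDegree (p + Pi.single i 1) := by
    rw [y.baseDegree_eq_self hp, baseDegree_eq_meet, hmeet]
  have hv : y.base p p le_rfl = y.base (p + Pi.single i 1) (p + Pi.single i 1) le_rfl :=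
    (y.base_congr_right hle hc le_rfl).symm.trans (y.base_congr_left hle hc le_rfl)
  rw [hv]
  refine Tilde.not_hasEdge_of_excess_ne_zero _ i ?_
  have h := y.excess_path_add (p + Pi.single i 1) (p + Pi.single i 1) le_rfl i
  rw [← hc, y.baseDegree_eq_self hp, Pi.add_apply, Pi.single_eq_same] at h
  omega

/-- The boundary path `π(y)` of `Λ`, given by `(p, q) ↦ π(y(p, q))` on `Ω_{k,d}`, where `d` is
the boundary degree of `y`. -/
noncomputable def toBoundary : Λ.BoundaryPath where
  deg := y.boundaryDegree
  hom := OmegaHom.ofMap (fun f => y.base f.p f.q f.le)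
    (fun f => y.d_base_of_le f.p f.q f.le f.le_deg)
    (fun p q t hpq hqt _ => y.base_comp p q t hpq hqt)
  boundary p hp i hi := y.not_hasEdge_of_eq_boundaryDegree p hp i hi

/-- Both `π(y(m ∧ d, m))` and `π(y(n ∧ d, n))` are identities. -/
theorem base_eq_base_meet (m n : Fin k → ℕ) (h : m ≤ n) :
    y.base m n h = y.base (meet m y.boundaryDegree) (meet n y.boundaryDegree)
      (meet_mono h _) := by
  have hc : ∀ m, y.baseDegree (meet m y.boundaryDegree) = y.baseDegree m := fun m => by
    rw [y.baseDegree_eq_self (meet_le_right m _), baseDegree_eq_meet]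
  exact (y.base_congr_left (meet_le_left m _) (hc m) h).symm.trans
    (y.base_congr_right (meet_le_left n _) (hc n) (meet_mono h _))

theorem eq_toInfinite_toBoundary : y = y.toBoundary.toInfinite hlc y.startExcess := by
  have hm : ∀ m, meet (y.startExcess + m) y.boundaryDegree = meet m y.boundaryDegree :=
    meet_add_of_meet_eq_zero y.meet_startExcess
  refine OmegaHom.ext_seg fun m n hmn _ => Tilde.mor_ext ?_ ?_ ?_
  · exact (y.base_eq_base_meet m n hmn).trans
      (y.toBoundary.hom.seg_congr (meet_mono hmn _) (meet_le_right n _) (hm m).symm (hm n).symm)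
  · funext i
    have h1 := y.excess_path_add m n hmn i
    have h2 := le_at (y.baseDegree_le m) i
    change Tilde.excess (y.path m n hmn) i =
      (y.startExcess + m) i - meet (y.startExcess + m) y.boundaryDegree i
    rw [hm, ← baseDegree_eq_meet, Pi.add_apply]
    omega
  · exact (y.degree_path m n hmn).trans (add_tsub_add_eq_tsub_left y.startExcess n m).symm

/-! ### Uniqueness -/

variable {y}

theorem base_eq_seg_meet {x : Λ.BoundaryPath} {p : Fin k → ℕ} (hp : meet p x.deg = 0)
    (hy : y = x.toInfinite hlc p) (m n : Fin k → ℕ) (hmn : m ≤ n) :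
    y.base m n hmn = x.seg (meet m x.deg) (meet n x.deg) (meet_mono hmn x.deg)
      (meet_le_right n x.deg) := by
  subst hy
  exact x.hom.seg_congr _ _ (meet_add_of_meet_eq_zero hp m) (meet_add_of_meet_eq_zero hp n)

theorem startExcess_eq {x : Λ.BoundaryPath} {p : Fin k → ℕ} (hp : meet p x.deg = 0)
    (hy : y = x.toInfinite hlc p) : y.startExcess = p := by
  subst hy
  change p + 0 - meet (p + 0) x.deg = p
  rw [add_zero, hp, tsub_zero]

theorem toBoundary_eq {x : Λ.BoundaryPath} {p : Fin k → ℕ} (hp : meet p x.deg = 0)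
    (hy : y = x.toInfinite hlc p) : y.toBoundary = x := by
  have hdeg : y.boundaryDegree = x.deg := eq_of_forall_meet_eq fun n => by
    have h0 : meet 0 x.deg = 0 := meet_eq_self (by simp)
    rw [← baseDegree_eq_meet, baseDegree, base_eq_seg_meet hp hy, BoundaryPath.seg,
      OmegaHom.d_seg, h0, tsub_zero]
  refine BoundaryPath.ext_seg hdeg fun m n hmn _ hn => ?_
  exact (base_eq_seg_meet hp hy m n hmn).trans
    (x.hom.seg_congr _ _ (meet_eq_self (le_deg_of_le hmn hn)) (meet_eq_self hn))

end InfinitePath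

end KGraph

theorem mainTheorem7 {k : ℕ} (hk : 0 < k) (Λ : KGraph.{u} k) (hrf : Λ.RowFinite)
    (hlc : Λ.LocallyConvex) (y : (Λ.tilde hlc).InfinitePath) :
    (∃! z : Λ.BoundaryPath × (Fin k → ℕ),
      KGraph.meet z.2 z.1.deg = 0 ∧ y = z.1.toInfinite hlc z.2) ∧
    ∀ (x : Λ.BoundaryPath) (p : Fin k → ℕ),
      KGraph.meet p x.deg = 0 → y = x.toInfinite hlc p →
      ∀ (m n : Fin k → ℕ) (hmn : m ≤ n),
        KGraph.Tilde.proj (y.path m n hmn) =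
          x.seg (KGraph.meet m x.deg) (KGraph.meet n x.deg) (KGraph.meet_mono hmn x.deg)
            (KGraph.meet_le_right n x.deg) := by
  refine ⟨⟨(y.toBoundary, y.startExcess), ⟨y.meet_startExcess, y.eq_toInfinite_toBoundary⟩, ?_⟩,
    fun x p hp hy => KGraph.InfinitePath.base_eq_seg_meet hp hy⟩
  rintro ⟨x, p⟩ ⟨hp, hy⟩
  exact Prod.ext (KGraph.InfinitePath.toBoundary_eq hp hy).symm
    (KGraph.InfinitePath.startExcess_eq hp hy).symm
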